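/- Let $V$ be a set and let $\pi$ be the uniform product measure on $\{0,1\}^V$ (independent fair bits). For an event $A\subseteq\{0,1\}^V$ depending on only finitely many coordinates, the influence $I_v(A)$ of $v\in V$ is the $\pi$-probability that changing the value of the coordinate $v$ changes whether $A$ occurs, and $I(A)=\sum_{v\in V}I_v(A)$ is the total influence. Let $(A_n)$ be a sequence of events in $\{0,1\}^V$, each depending on only finitely many coordinates, with $\lim_{n\to\infty}\pi(A_n)=0$. Let $(\omega_t)_{t\ge 0}$ be the Markov process on $\{0,1\}^V$ started from $\pi$ in which the coordinates evolve independently, each as a continuous-time Markov chain with right-continuous paths a.s. that goes from $0$ to $1$ at rate $1/2$ and from $1$ to $0$ at rate $1/2$. Let $T=\{t\ge 0:\omega_t\in\bigcap_n A_n\}$. If $\liminf_{n\to\infty}I(A_n)<\infty$, then a.s. $T=\emptyset$. Otherwise, a.s. the Hausdorff dimension of $T$ is at most $$\liminf_{n\to\infty}\left(1-\frac{\log \pi(A_n)}{\log I(A_n)}\right)^{-1}.$$ -/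

import Mathlib

open MeasureTheory ProbabilityTheory Filter Topology
open scoped ENNReal NNReal

/-- The stationary distribution on `{0,1}^V`: independent fair bits (`true` is `1`). -/
noncomputable def fairBits (V : Type*) : Measure (V → Bool) :=
  Measure.infinitePi fun _ : V => (PMF.uniformOfFintype Bool).toMeasure

/-- The configurations at which the coordinate `v` is pivotal for the event `A`: changing the
value at `v` changes whether `A` occurs. -/
def pivotalSet {V : Type*} [DecidableEq V] (A : Set (V → Bool)) (v : V) : Set (V → Bool) :=
  {x | ¬ (Function.update x v (!x v) ∈ A ↔ x ∈ A)}

open Classical in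
/-- The influence of the coordinate `v` on `A`: the probability that `v` is pivotal for `A`. -/
noncomputable def influence {V : Type*} (A : Set (V → Bool)) (v : V) : ℝ≥0∞ :=
  fairBits V (pivotalSet A v)

/-- The total influence `I(A)`: the sum of all the influences (a finite number when `A` depends
on finitely many coordinates). -/
noncomputable def totalInfluence {V : Type*} (A : Set (V → Bool)) : ℝ≥0∞ :=
  ∑' v, influence A v

/-- The generator (matrix of jump rates) of one bit: `0` goes to `1` at rate `1/2`, and `1` goes
to `0` at rate `1/2`. -/
noncomputable def flipGenerator : Matrix Bool Bool ℝ :=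
  Matrix.of fun a b => if a = b then -(1 / 2) else 1 / 2

/-- The transition matrix `exp (t Q)` of one bit over a time interval of length `t`. -/
noncomputable def flipTransition (t : ℝ) : Matrix Bool Bool ℝ :=
  NormedSpace.exp (t • flipGenerator)

theorem flipTransition_apply (t : ℝ) (a b : Bool) :
    flipTransition t a b =
      if a = b then (1 + Real.exp (-t)) / 2 else (1 - Real.exp (-t)) / 2 := by
  let U : Matrix Bool Bool ℝ := Matrix.of fun a b => if a && b then -1 else 1
  let W : Matrix Bool Bool ℝ := Matrix.of fun a b => if a && b then -(1 / 2) else 1 / 2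
  let u : (Matrix Bool Bool ℝ)ˣ :=
    ⟨U, W, by
      ext a b; cases a <;> cases b <;> norm_num [U, W, Matrix.mul_apply],
     by
      ext a b; cases a <;> cases b <;> norm_num [U, W, Matrix.mul_apply]⟩
  let d : Bool → ℝ := fun a => if a then -t else 0
  have h : t • flipGenerator =
      (u : Matrix Bool Bool ℝ) * Matrix.diagonal d * (↑u⁻¹ : Matrix Bool Bool ℝ) := by
    change t • flipGenerator = U * Matrix.diagonal d * W
    ext a b
    cases a <;> cases b <;>
      simp [U, W, d, flipGenerator, Matrix.mul_apply, Matrix.diagonal]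
  rw [flipTransition, h, Matrix.exp_units_conj, Matrix.exp_diagonal]
  change (U * Matrix.diagonal (NormedSpace.exp d) * W) a b = _
  have hd : NormedSpace.exp d = fun a => if a then Real.exp (-t) else 1 := by
    rw [Pi.exp_def]
    funext a
    cases a <;> simp [d, Real.exp_eq_exp_ℝ]
  rw [hd]
  cases a <;> cases b <;>
    simp [U, W, Matrix.mul_apply, Matrix.diagonal] <;> ring

/-- `X t s v` (time `t`, sample `s`, coordinate `v`) is the stationary flip dynamics on `{0,1}^V`
under the probability measure `P`: the coordinates evolve as independent processes with right
continuous paths, and each of them is a Markov chain on `{0,1}` with jump rates `1/2`, started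
from the uniform distribution. The last point is expressed by the finite-dimensional
distributions of the chain. -/
structure IsFlipDynamics {V Ω : Type*} [MeasurableSpace Ω] (P : Measure Ω)
    (X : ℝ≥0 → Ω → V → Bool) : Prop where
  measurable : ∀ t v, Measurable fun s => X t s v
  indep : iIndepFun (fun (v : V) (s : Ω) (t : ℝ≥0) => X t s v) P
  rightCont : ∀ v, ∀ᵐ s ∂P, ∀ t, ContinuousWithinAt (fun r => X r s v) (Set.Ici t) t
  law : ∀ (v : V) (n : ℕ) (t : Fin (n + 1) → ℝ≥0), Monotone t → ∀ a : Fin (n + 1) → Bool,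
    P.real {s | ∀ i, X (t i) s v = a i} =
      1 / 2 * ∏ i : Fin n,
        flipTransition ((t i.succ : ℝ) - (t i.castSucc : ℝ)) (a i.castSucc) (a i.succ)

/-- The set of exceptional times of a trajectory `x`: the times at which it lies in every
`A n`. -/
def exceptionalTimes {V : Type*} (A : ℕ → Set (V → Bool)) (x : ℝ≥0 → V → Bool) : Set ℝ≥0 :=
  {t | x t ∈ ⋂ n, A n}

/-! Everything starts from a first-moment estimate. Moving the coordinates one at a time from time
`s` to time `t` shows that `A` changes between these times with probability at most `(t - s) / 2 *
I(A)` (`measure_change_le`). A visit to `A` during a period of length `ℓ` is either present at the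
start or entered later, so its probability is at most `π(A) + ℓ I(A) / 2`
(`measureReal_dyadicHit_le`).

Dimension bound: for `ε = π(A) / I(A)` the two terms are comparable, and the expected number of
intervals of length `ε` meeting `A` before time `L` is of order `I(A)`. The cost `I(A) ε ^ d` is
less than `1` as soon as `d` exceeds the exponent in the theorem. Fatou's lemma along a subsequence
then gives Hausdorff measure zero (`ae_dimH_le`).

Emptiness: with influences bounded by `C`, the first moment only bounds the hitting probability, and
the gain comes from reversibility (`measureReal_hit_le`). Cut `[0, L)` into `K` periods of length
`ℓ`, let `G` be a finite intersection of the events, and let `D` be the intersection of `G` with a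
much later event. Unless `D` is met in the last period, its last visit is followed by a whole period
free of `D`. Departures from `D` to points from which such a period has probability at most `lam`
cost about `lam L C / 2`. For the other departures, reverse time: the same flow is that of first
entrances into `D`, after a `D`-free stretch, from points where `D` is likely to be avoided. Just
before such an entrance the chain is already in `G`, except when a coordinate of `G` flips at the
entrance, which is negligible as `π(D) → 0`. From such a point of `G` the chain avoids `D` for
another period with probability above `lam`. Hence these entrances are rare if `G` is rarely visited
without `D`, and this is so because hitting probabilities of decreasing events converge. What
remains is `ℓ C / 2 + lam L C / 2`, with `ℓ` and `lam` arbitrarily small. -/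

/-! ### Finitely determined events, pivotality and influence. -/

theorem DependsOn.eq_preimage_restrict {V : Type*} {A : Set (V → Bool)} {F : Finset V}
    (hA : DependsOn (fun x => x ∈ A) (F : Set V)) :
    A = F.restrict ⁻¹' (F.restrict '' A) := by
  ext x
  refine ⟨fun h => ⟨x, h, rfl⟩, ?_⟩
  rintro ⟨y, hy, hxy⟩
  have : (y ∈ A) = (x ∈ A) := hA fun i hi => congrFun hxy ⟨i, hi⟩
  exact this ▸ hy

theorem DependsOn.measurableSet_of_finset {V : Type*} {A : Set (V → Bool)} {F : Finset V}
    (hA : DependsOn (fun x => x ∈ A) (F : Set V)) : MeasurableSet A := by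
  rw [hA.eq_preimage_restrict]
  exact (Finset.measurable_restrict F) (Set.toFinite _).measurableSet

instance fairBits.isProbabilityMeasure {V : Type*} : IsProbabilityMeasure (fairBits V) := by
  unfold fairBits; infer_instance

theorem fairBits_flip_preimage {V : Type*} [DecidableEq V] (v : V) {A : Set (V → Bool)}
    (hA : MeasurableSet A) :
    fairBits V ((fun x => Function.update x v (!x v)) ⁻¹' A) = fairBits V A := by
  have hflip : Measure.map (fun b : Bool => !b) (PMF.uniformOfFintype Bool).toMeasure =
      (PMF.uniformOfFintype Bool).toMeasure := by
    refine Measure.ext_of_singleton fun b => ?_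
    rw [Measure.map_apply (by fun_prop) (measurableSet_singleton b)]
    have : (fun b : Bool => !b) ⁻¹' {b} = {!b} := by ext c; cases b <;> cases c <;> simp
    rw [this, PMF.toMeasure_apply_singleton _ _ (by measurability),
      PMF.toMeasure_apply_singleton _ _ (by measurability)]
    simp
  have h := Measure.infinitePi_map_pi (μ := fun _ : V => (PMF.uniformOfFintype Bool).toMeasure)
    (f := fun u b => if u = v then !b else b) (fun u => by fun_prop)
  have h2 : (fun u : V => Measure.map (fun b => if u = v then !b else b)
      (PMF.uniformOfFintype Bool).toMeasure) = fun _ => (PMF.uniformOfFintype Bool).toMeasure := by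
    funext u
    by_cases hu : u = v
    · simp [hu, hflip]
    · simp [hu]
  rw [h2] at h
  have hf : (fun x : V → Bool => Function.update x v (!x v)) =
      fun x u => if u = v then !(x u) else x u := by
    funext x u
    by_cases hu : u = v
    · subst hu; simp
    · simp [hu]
  conv_rhs => rw [fairBits, ← h, Measure.map_apply (by fun_prop) hA]
  rw [hf, fairBits]

theorem pivotalSet_eq_empty {V : Type*} [DecidableEq V] {A : Set (V → Bool)} {F : Finset V}
    (hA : DependsOn (fun x => x ∈ A) (F : Set V)) {v : V} (hv : v ∉ F) : pivotalSet A v = ∅ := by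
  ext x
  have := hA (x := Function.update x v (!x v)) (y := x) fun i hi => by
    rw [Function.update_of_ne]; rintro rfl; exact hv hi
  simpa [pivotalSet] using this

/-- Pivotality is a property of the unordered pair formed by `x` and its flip at `v`. It is
therefore independent of the path of the coordinate `v`. -/
theorem dependsOn_pivotalSet {V : Type*} [DecidableEq V] {A : Set (V → Bool)} {F : Finset V}
    (hA : DependsOn (fun x => x ∈ A) (F : Set V)) (v : V) :
    DependsOn (fun x => x ∈ pivotalSet A v) ((F.erase v : Finset V) : Set V) := by
  intro x y hxy
  have key : ∀ b, (Function.update x v b ∈ A) = (Function.update y v b ∈ A) := fun b =>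
    hA fun i hi => by
      by_cases h : i = v
      · subst h; simp
      · simp [h]; exact hxy i (by simp [h]; exact hi)
  have kx : x = Function.update x v (x v) := by simp
  have ky : y = Function.update y v (y v) := by simp
  simp only [pivotalSet, Set.mem_ofPred_eq]
  conv_lhs => rw [show (x ∈ A) = (Function.update x v (x v) ∈ A) by simp]
  conv_rhs => rw [show (y ∈ A) = (Function.update y v (y v) ∈ A) by simp]
  simp only [key]
  cases x v <;> cases y v <;> simp [iff_comm]

/-- Symmetrizing in `v` makes the event independent of the path of `v`, at the price of at most
doubling its probability. -/
theorem dependsOn_union_flip {V : Type*} [DecidableEq V] {A : Set (V → Bool)} {F : Finset V}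
    (hA : DependsOn (fun x => x ∈ A) (F : Set V)) (v : V) :
    DependsOn (fun x => x ∈ A ∪ (fun x => Function.update x v (!x v)) ⁻¹' A)
      ((F.erase v : Finset V) : Set V) := by
  intro x y hxy
  have key : ∀ b, (Function.update x v b ∈ A) = (Function.update y v b ∈ A) := fun b =>
    hA fun i hi => by
      by_cases h : i = v
      · subst h; simp
      · simp [h]; exact hxy i (by simp [h]; exact hi)
  simp only [Set.mem_union, Set.mem_preimage]
  conv_lhs => rw [show (x ∈ A) = (Function.update x v (x v) ∈ A) by simp]
  conv_rhs => rw [show (y ∈ A) = (Function.update y v (y v) ∈ A) by simp]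
  simp only [key]
  cases x v <;> cases y v <;> simp [or_comm]

open Classical in
theorem totalInfluence_eq_sum {V : Type*} {A : Set (V → Bool)} {F : Finset V}
    (hA : DependsOn (fun x => x ∈ A) (F : Set V)) :
    totalInfluence A = ∑ v ∈ F, influence A v :=
  tsum_eq_sum fun v hv => by
    rw [influence, pivotalSet_eq_empty hA hv, measure_empty]

theorem totalInfluence_ne_top {V : Type*} {A : Set (V → Bool)} {F : Finset V}
    (hA : DependsOn (fun x => x ∈ A) (F : Set V)) : totalInfluence A ≠ ⊤ := by
  classical
  rw [totalInfluence_eq_sum hA]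
  exact ENNReal.sum_ne_top.2 fun v _ => by rw [influence]; exact measure_ne_top _ _

theorem dependsOn_inter {V : Type*} {A B : Set (V → Bool)} {S T : Set V}
    (hA : DependsOn (fun x => x ∈ A) S) (hB : DependsOn (fun x => x ∈ B) T) :
    DependsOn (fun x => x ∈ A ∩ B) (S ∪ T) := by
  intro x y hxy
  have h1 := hA fun i hi => hxy i (Or.inl hi)
  have h2 := hB fun i hi => hxy i (Or.inr hi)
  simp only at h1 h2
  simp only [Set.mem_inter_iff, h1, h2]

/-- If `v` is pivotal for `A ∩ B` but not for `A`, then `A` occurs and `v` is pivotal for `B`, so `v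
∈ F`. For fixed `B`, the extra term vanishes with the probability of `A`. -/
theorem totalInfluence_inter_le {V : Type*} {A B : Set (V → Bool)} {F : Finset V}
    (hB : DependsOn (fun x => x ∈ B) (F : Set V)) :
    totalInfluence (A ∩ B) ≤ totalInfluence A + F.card * fairBits V A := by
  classical
  have h : ∀ v, influence (A ∩ B) v ≤ influence A v + if v ∈ F then fairBits V A else 0 := by
    intro v
    have hp : pivotalSet (A ∩ B) v ⊆ pivotalSet A v ∪ (if v ∈ F then A else ∅) := by
      intro x hx
      by_cases hv : v ∈ F
      · simp only [pivotalSet, Set.mem_ofPred_eq, Set.mem_inter_iff, Set.mem_union, hv, if_true] at *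
        tauto
      · have : (Function.update x v (!x v) ∈ B) = (x ∈ B) := hB fun i hi => by
          rw [Function.update_of_ne]; rintro rfl; exact hv hi
        simp only [pivotalSet, Set.mem_ofPred_eq, Set.mem_inter_iff, Set.mem_union, hv, this] at *
        tauto
    refine (measure_mono hp).trans ((measure_union_le _ _).trans ?_)
    refine add_le_add (by rw [influence]) ?_
    split_ifs <;> simp
  calc totalInfluence (A ∩ B) ≤ ∑' v, (influence A v + if v ∈ F then fairBits V A else 0) :=
        ENNReal.tsum_le_tsum h
    _ = totalInfluence A + ∑' v, (if v ∈ F then fairBits V A else 0) := ENNReal.tsum_add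
    _ = _ := by
      rw [tsum_eq_sum (s := F) (fun v hv => by simp [hv])]
      simp [Finset.sum_ite_mem]

/-! ### Stationarity and changes of an event between two times. -/

namespace IsFlipDynamics

variable {V Ω : Type*} [MeasurableSpace Ω] {P : Measure Ω} {X : ℝ≥0 → Ω → V → Bool}

theorem measurable_path (hX : IsFlipDynamics P X) (v : V) :
    Measurable fun (s : Ω) (t : ℝ≥0) => X t s v :=
  measurable_pi_iff.2 fun t => hX.measurable t v

theorem measurable_mixed (hX : IsFlipDynamics P X) (r : V → ℝ≥0) :
    Measurable fun s v => X (r v) s v :=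
  measurable_pi_iff.2 fun v => hX.measurable (r v) v

theorem measurable_eval (hX : IsFlipDynamics P X) (t : ℝ≥0) : Measurable (X t) :=
  hX.measurable_mixed fun _ => t

theorem map_coordinate [IsProbabilityMeasure P] (hX : IsFlipDynamics P X) (t : ℝ≥0) (v : V) :
    P.map (fun s => X t s v) = (PMF.uniformOfFintype Bool).toMeasure := by
  refine Measure.ext_of_singleton fun b => ?_
  rw [Measure.map_apply (hX.measurable t v) (measurableSet_singleton b),
    PMF.toMeasure_apply_singleton _ _ (by measurability)]
  have h := hX.law v 0 (fun _ => t) (fun _ _ _ => le_rfl) (fun _ => b)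
  have h2 : {s | ∀ _ : Fin (0 + 1), X t s v = b} = (fun s => X t s v) ⁻¹' {b} := by
    ext s; simp
  rw [h2, measureReal_def] at h
  rw [← ENNReal.ofReal_toReal (measure_ne_top P _), h]
  simp [ENNReal.ofReal_inv_of_pos]

/-- Reading each coordinate at its own time gives a configuration of independent fair bits. -/
theorem map_mixed [IsProbabilityMeasure P] (hX : IsFlipDynamics P X) (r : V → ℝ≥0) :
    P.map (fun s v => X (r v) s v) = fairBits V := by
  have h := hX.indep.comp (fun v (y : ℝ≥0 → Bool) => y (r v)) fun v => measurable_pi_apply (r v)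
  have h2 := h.map_fun_eq_infinitePi_map fun v => hX.measurable (r v) v
  rw [h2, fairBits]
  congr 1
  funext v
  exact hX.map_coordinate (r v) v

theorem measure_mixed_mem [IsProbabilityMeasure P] (hX : IsFlipDynamics P X) (r : V → ℝ≥0)
    {A : Set (V → Bool)} (hA : MeasurableSet A) :
    P {s | (fun v => X (r v) s v) ∈ A} = fairBits V A := by
  rw [← hX.map_mixed r, Measure.map_apply (hX.measurable_mixed r) hA]
  rfl

theorem measure_mem [IsProbabilityMeasure P] (hX : IsFlipDynamics P X) (t : ℝ≥0)
    {A : Set (V → Bool)} (hA : MeasurableSet A) : P {s | X t s ∈ A} = fairBits V A :=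
  hX.measure_mixed_mem (fun _ => t) hA

/-- The exact value is `(1 - exp (-(t - s))) / 2`, half of it from each direction of change. -/
theorem measure_ne_le [IsProbabilityMeasure P] (hX : IsFlipDynamics P X) {s t : ℝ≥0}
    (hst : s ≤ t) (v : V) :
    P {w | X s w v ≠ X t w v} ≤ ENNReal.ofReal (((t : ℝ) - s) / 2) := by
  have h : ∀ a, P {w | X s w v = a ∧ X t w v = !a} =
      ENNReal.ofReal (1 / 2 * ((1 - Real.exp (-((t : ℝ) - s))) / 2)) := by
    intro a
    have h := hX.law v 1 ![s, t]
      (by intro i j hij; fin_cases i <;> fin_cases j <;> simp_all) ![a, !a]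
    rw [← ENNReal.ofReal_toReal (measure_ne_top P _), ← measureReal_def]
    have h2 : {w | X s w v = a ∧ X t w v = !a} =
        {w | ∀ i, X ((![s, t] : Fin 2 → ℝ≥0) i) w v = (![a, !a] : Fin 2 → Bool) i} := by
      ext w; simp [Fin.forall_fin_two]
    rw [h2]
    erw [h]
    simp [flipTransition_apply]
  have hsub : {w | X s w v ≠ X t w v} ⊆
      {w | X s w v = true ∧ X t w v = !true} ∪ {w | X s w v = false ∧ X t w v = !false} := by
    intro w hw
    simp only [Set.mem_ofPred_eq, Set.mem_union] at *
    revert hw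
    cases X s w v <;> cases X t w v <;> simp
  refine (measure_mono hsub).trans ((measure_union_le _ _).trans ?_)
  have h0 : 0 ≤ (t : ℝ) - s := sub_nonneg.2 (by exact_mod_cast hst)
  have h1 := Real.add_one_le_exp (-((t : ℝ) - s))
  have h3 : Real.exp (-((t : ℝ) - s)) ≤ 1 := Real.exp_le_one_iff.2 (by linarith)
  rw [h, h, ← ENNReal.ofReal_add (by linarith) (by linarith)]
  exact ENNReal.ofReal_le_ofReal (by linarith)

/-- Independence of the path of `v` from the paths over `F`. Each coordinate has its own reading
time so that the lemma applies to the hybrid configurations between times `s` and `t`. -/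
theorem measure_inter_ne_eq [IsProbabilityMeasure P] (hX : IsFlipDynamics P X)
    {A : Set (V → Bool)} {F : Finset V} (hA : DependsOn (fun x => x ∈ A) (F : Set V)) {v : V}
    (hv : v ∉ F) (r : V → ℝ≥0) (s t : ℝ≥0) :
    P ({w | (fun u => X (r u) w u) ∈ A} ∩ {w | X s w v ≠ X t w v}) =
      fairBits V A * P {w | X s w v ≠ X t w v} := by
  classical
  have h := hX.indep.indepFun_finset F {v} (by simpa using hv) hX.measurable_path
  have h2 := h.measure_inter_preimage_eq_mul
    ((fun (y : F → ℝ≥0 → Bool) (i : F) => y i (r i)) ⁻¹' (F.restrict '' A))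
    {y | y ⟨v, by simp⟩ s ≠ y ⟨v, by simp⟩ t}
    ((show Measurable fun (y : F → ℝ≥0 → Bool) (i : F) => y i (r i) by fun_prop)
      (Set.toFinite _).measurableSet)
    (measurableSet_eq_fun (by fun_prop) (by fun_prop)).compl
  have e1 : (fun (a : Ω) (i : F) (t : ℝ≥0) => X t a i) ⁻¹'
      ((fun (y : F → ℝ≥0 → Bool) (i : F) => y i (r i)) ⁻¹' (F.restrict '' A)) =
      {w | (fun u => X (r u) w u) ∈ A} := by
    conv_rhs => rw [hA.eq_preimage_restrict]
    rfl
  rw [e1, hX.measure_mixed_mem r hA.measurableSet_of_finset] at h2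
  exact h2

/-- The probability that the event `A` occurs at exactly one of the times `s` and `t`. -/
theorem measure_change_le [IsProbabilityMeasure P] (hX : IsFlipDynamics P X) {s t : ℝ≥0}
    (hst : s ≤ t) {A : Set (V → Bool)} {F : Finset V}
    (hA : DependsOn (fun x => x ∈ A) (F : Set V)) :
    P {w | ¬ (X s w ∈ A ↔ X t w ∈ A)} ≤
      ENNReal.ofReal (((t : ℝ) - s) / 2) * totalInfluence A := by
  classical
  -- Hybrid argument: the coordinates in `S` are already read at time `t`, the others still at time
  -- `s`. Moving one more coordinate `v` matters only if `v` changes while pivotal for the hybrid.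
  have key : ∀ S ⊆ F, P {w | ¬ (X s w ∈ A ↔ (fun u => X (if u ∈ S then t else s) w u) ∈ A)} ≤
      ENNReal.ofReal (((t : ℝ) - s) / 2) * ∑ v ∈ S, influence A v := by
    intro S
    induction S using Finset.induction_on with
    | empty => intro _; simp
    | insert v S hvS ih =>
      intro hS
      have ih := ih ((Finset.subset_insert v S).trans hS)
      rw [Finset.sum_insert hvS, mul_add, add_comm]
      have hsub : {w | ¬ (X s w ∈ A ↔
            (fun u => X (if u ∈ insert v S then t else s) w u) ∈ A)} ⊆
          {w | ¬ (X s w ∈ A ↔ (fun u => X (if u ∈ S then t else s) w u) ∈ A)} ∪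
          ({w | (fun u => X (if u ∈ S then t else s) w u) ∈ pivotalSet A v} ∩
            {w | X s w v ≠ X t w v}) := by
        intro w hw
        by_contra hcon
        simp only [Set.mem_union, Set.mem_inter_iff, Set.mem_ofPred_eq, not_or, not_not,
          not_and] at hw hcon
        obtain ⟨h1, h2⟩ := hcon
        apply hw
        rw [h1]
        by_cases hne : X s w v = X t w v
        · have : (fun u => X (if u ∈ insert v S then t else s) w u) =
              fun u => X (if u ∈ S then t else s) w u := by
            funext u
            by_cases hu : u = v
            · subst hu; simp [hvS, hne]
            · simp [hu]
          rw [this]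
        · have h3 : (fun u => X (if u ∈ insert v S then t else s) w u) =
              Function.update (fun u => X (if u ∈ S then t else s) w u) v
                (!(X (if v ∈ S then t else s) w v)) := by
            funext u
            by_cases hu : u = v
            · subst hu
              simp only [Finset.mem_insert_self, if_true, Function.update_self, hvS, if_false]
              revert hne
              cases X s w u <;> cases X t w u <;> simp
            · simp [hu]
          have h4 : (fun u => X (if u ∈ S then t else s) w u) ∉ pivotalSet A v :=
            fun h => hne (h2 h)
          rw [h3]
          simp only [pivotalSet, Set.mem_ofPred_eq, not_not] at h4
          exact h4.symm
      refine (measure_mono hsub).trans ((measure_union_le _ _).trans (add_le_add ih ?_))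
      rw [hX.measure_inter_ne_eq (dependsOn_pivotalSet hA v) (Finset.notMem_erase v F)
        (fun u => if u ∈ S then t else s) s t, mul_comm, influence]
      refine mul_le_mul' (hX.measure_ne_le hst v) (le_of_eq ?_)
      congr
  have h := key F subset_rfl
  rw [totalInfluence_eq_sum hA]
  refine le_trans (measure_mono fun w hw => ?_) h
  have h2 : ((fun u => X (if u ∈ F then t else s) w u) ∈ A) = (X t w ∈ A) :=
    hA fun u hu => by simp [Finset.mem_coe.1 hu]
  simpa only [Set.mem_ofPred_eq, h2] using hw

/-- The probability that `A` occurs at time `t` and that some coordinate in `F` differs at the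
times `s` and `t`. -/
theorem measure_mem_inter_ne_le [IsProbabilityMeasure P] (hX : IsFlipDynamics P X) {s t : ℝ≥0}
    (hst : s ≤ t) {A : Set (V → Bool)} {H : Finset V}
    (hA : DependsOn (fun x => x ∈ A) (H : Set V)) (F : Finset V) :
    P {w | X t w ∈ A ∧ ∃ v ∈ F, X s w v ≠ X t w v} ≤
      F.card * (fairBits V A * ENNReal.ofReal ((t : ℝ) - s)) := by
  classical
  -- Enlarging `A` to its symmetrization in `v` restores independence from the change of `v`; the
  -- factor `2` lost cancels the rate `1 / 2`.
  have hsub : {w | X t w ∈ A ∧ ∃ v ∈ F, X s w v ≠ X t w v} ⊆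
      ⋃ v ∈ F, ({w | X t w ∈ A ∪ (fun x => Function.update x v (!x v)) ⁻¹' A} ∩
        {w | X s w v ≠ X t w v}) := by
    rintro w ⟨h1, v, hv, h2⟩
    simp only [Set.mem_iUnion]
    exact ⟨v, hv, Or.inl h1, h2⟩
  refine (measure_mono hsub).trans ((measure_biUnion_finset_le _ _).trans ?_)
  rw [← nsmul_eq_mul]
  refine Finset.sum_le_card_nsmul _ _ _ fun v _ => ?_
  have hm := hA.measurableSet_of_finset
  have h := hX.measure_inter_ne_eq (dependsOn_union_flip hA v) (Finset.notMem_erase v H)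
    (fun _ => t) s t
  rw [h]
  have h2 : fairBits V (A ∪ (fun x => Function.update x v (!x v)) ⁻¹' A) ≤ 2 * fairBits V A := by
    refine (measure_union_le _ _).trans ?_
    rw [fairBits_flip_preimage v hm, two_mul]
  refine (mul_le_mul' h2 (hX.measure_ne_le hst v)).trans (le_of_eq ?_)
  rw [ENNReal.ofReal_div_of_pos two_pos, mul_comm 2, mul_assoc]
  congr 1
  rw [ENNReal.ofReal_ofNat, ENNReal.mul_div_cancel (by simp) (by simp)]

end IsFlipDynamics

/-! ### Reversible finite chains and avoidance probabilities. -/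

/-- `Y` is a Markov chain on the finite space `E` with symmetric transition matrix `p`, each
`Y n` giving mass `c` to every point. -/
structure IsSymmChain {Ω E : Type*} [MeasurableSpace Ω] (P : Measure Ω) (Y : ℕ → Ω → E)
    (p : E → E → ℝ) (c : ℝ) : Prop where
  measurableSet_eq : ∀ n x, MeasurableSet {w | Y n w = x}
  nonneg : ∀ x y, 0 ≤ p x y
  symm : ∀ x y, p x y = p y x
  markov : ∀ (n : ℕ) (φ : (ℕ → E) → Prop), (∀ a b, (∀ i ≤ n, a i = b i) → φ a → φ b) →
    ∀ x y, P.real {w | φ (fun i => Y i w) ∧ Y n w = x ∧ Y (n + 1) w = y} =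
      P.real {w | φ (fun i => Y i w) ∧ Y n w = x} * p x y
  stationary : ∀ n x, P.real {w | Y n w = x} = c

/-- The probability that the chain with transition matrix `p` started from `x` avoids `D` at the
times `0, …, k`. -/
noncomputable def avoidProb {E : Type*} [Fintype E] (p : E → E → ℝ) (D : Set E) : ℕ → E → ℝ
  | 0 => Dᶜ.indicator fun _ => 1
  | k + 1 => Dᶜ.indicator fun x => ∑ y, p x y * avoidProb p D k y

namespace IsSymmChain

variable {Ω E : Type*} [MeasurableSpace Ω] {P : Measure Ω} [Fintype E]
  {Y : ℕ → Ω → E} {p : E → E → ℝ} {c : ℝ}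

theorem measurableSet_rel (h : IsSymmChain P Y p c) (n : ℕ) (S : Set E) :
    MeasurableSet {w | Y n w ∈ S} := by
  have : {w | Y n w ∈ S} = ⋃ x ∈ S, {w | Y n w = x} := by ext w; simp
  rw [this]
  exact (Set.toFinite S).measurableSet_biUnion fun x _ => h.measurableSet_eq n x

theorem measurableSet_forall_le (h : IsSymmChain P Y p c) (n k : ℕ) (S : Set E) :
    MeasurableSet {w | ∀ i, n ≤ i → i ≤ k → Y i w ∈ S} := by
  simp only [Set.ofPred_forall]
  exact .iInter fun i => .iInter fun _ => .iInter fun _ => h.measurableSet_rel i S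

/-- Every event determined by the chain up to time `n` is measurable. -/
theorem measurableSet_past (h : IsSymmChain P Y p c) (n : ℕ) (φ : (ℕ → E) → Prop)
    (hφ : ∀ a b, (∀ i ≤ n, a i = b i) → φ a → φ b) :
    MeasurableSet {w | φ fun i => Y i w} := by
  classical
  rcases isEmpty_or_nonempty E with hE | ⟨⟨e⟩⟩
  · have : IsEmpty Ω := ⟨fun w => hE.elim (Y 0 w)⟩
    exact Set.eq_empty_of_isEmpty {w | φ fun i => Y i w} ▸ MeasurableSet.empty
  -- The value `e` after time `n` is arbitrary, since `φ` only looks at times up to `n`.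
  let ext : (Fin (n + 1) → E) → ℕ → E := fun a i => if hi : i < n + 1 then a ⟨i, hi⟩ else e
  have : {w | φ fun i => Y i w} =
      ⋃ a ∈ {a | φ (ext a)}, ⋂ i : Fin (n + 1), {w | Y i w = a i} := by
    ext w
    simp only [Set.mem_ofPred_eq, Set.mem_iUnion, Set.mem_iInter, exists_prop]
    constructor
    · intro hw
      exact ⟨fun i => Y i w, hφ _ _ (fun i hi => by simp [ext, hi]) hw,
        fun i => rfl⟩
    · rintro ⟨a, ha, hw⟩
      refine hφ _ _ (fun i hi => ?_) ha
      have := hw ⟨i, Nat.lt_succ_of_le hi⟩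
      simp only at this
      simp [ext, hi, this]
  rw [this]
  exact (Set.toFinite _).measurableSet_biUnion fun a _ => .iInter fun i =>
    h.measurableSet_eq i (a i)

theorem avoidProb_nonneg (h : IsSymmChain P Y p c) (D : Set E) (k : ℕ) (x : E) :
    0 ≤ avoidProb p D k x := by
  induction k generalizing x with
  | zero => exact Set.indicator_nonneg (fun _ _ => zero_le_one) x
  | succ k ih =>
    exact Set.indicator_nonneg (fun x _ => Finset.sum_nonneg fun y _ =>
      mul_nonneg (h.nonneg x y) (ih y)) x

variable [IsProbabilityMeasure P]

theorem measureReal_eq_sum (h : IsSymmChain P Y p c) (n : ℕ) {S : Set Ω} (hS : MeasurableSet S) :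
    P.real S = ∑ x, P.real (S ∩ {w | Y n w = x}) := by
  rw [← measureReal_biUnion_finset]
  · congr 1
    ext w
    simp
  · intro x _ y _ hxy
    refine Set.disjoint_left.2 fun w hx hy => hxy ?_
    exact hx.2.symm.trans hy.2
  · exact fun x _ => hS.inter (h.measurableSet_eq n x)

/-- Iterated Markov property. The past event `φ` is kept general because each step of the induction
absorbs the current position into it. -/
theorem measureReal_avoid (h : IsSymmChain P Y p c) (D : Set E) (k : ℕ) :
    ∀ (n : ℕ) (φ : (ℕ → E) → Prop), (∀ a b, (∀ i ≤ n, a i = b i) → φ a → φ b) → ∀ x,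
      P.real {w | (φ (fun i => Y i w) ∧ Y n w = x) ∧ ∀ i, n ≤ i → i ≤ n + k → Y i w ∉ D} =
        P.real {w | φ (fun i => Y i w) ∧ Y n w = x} * avoidProb p D k x := by
  induction k with
  | zero =>
    intro n φ hφ x
    by_cases hx : x ∈ D
    · have : {w | (φ (fun i => Y i w) ∧ Y n w = x) ∧ ∀ i, n ≤ i → i ≤ n + 0 → Y i w ∉ D} = ∅ := by
        ext w
        simp only [Set.mem_ofPred_eq, Set.mem_empty_iff_false, iff_false]
        rintro ⟨⟨-, rfl⟩, h2⟩
        exact h2 n le_rfl le_rfl hx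
      rw [this]
      simp [avoidProb, hx]
    · have : {w | (φ (fun i => Y i w) ∧ Y n w = x) ∧ ∀ i, n ≤ i → i ≤ n + 0 → Y i w ∉ D} =
          {w | φ (fun i => Y i w) ∧ Y n w = x} := by
        ext w
        simp only [Set.mem_ofPred_eq, and_iff_left_iff_imp]
        rintro ⟨-, rfl⟩ i h1 h2
        rwa [le_antisymm h2 h1]
      rw [this]
      simp [avoidProb, hx]
  | succ k ih =>
    intro n φ hφ x
    by_cases hx : x ∈ D
    · have : {w | (φ (fun i => Y i w) ∧ Y n w = x) ∧
          ∀ i, n ≤ i → i ≤ n + (k + 1) → Y i w ∉ D} = ∅ := by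
        ext w
        simp only [Set.mem_ofPred_eq, Set.mem_empty_iff_false, iff_false]
        rintro ⟨⟨-, rfl⟩, h2⟩
        exact h2 n le_rfl (by omega) hx
      rw [this]
      simp [avoidProb, hx]
    · rw [h.measureReal_eq_sum (n + 1)]
      · have e : ∀ y, {w | (φ (fun i => Y i w) ∧ Y n w = x) ∧
            ∀ i, n ≤ i → i ≤ n + (k + 1) → Y i w ∉ D} ∩ {w | Y (n + 1) w = y} =
            {w | ((φ (fun i => Y i w) ∧ Y n w = x) ∧ Y (n + 1) w = y) ∧
              ∀ i, n + 1 ≤ i → i ≤ n + 1 + k → Y i w ∉ D} := by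
          intro y
          ext w
          simp only [Set.mem_inter_iff, Set.mem_ofPred_eq]
          constructor
          · rintro ⟨⟨h1, h2⟩, h3⟩
            exact ⟨⟨h1, h3⟩, fun i hi hi2 => h2 i (by omega) (by omega)⟩
          · rintro ⟨⟨h1, h3⟩, h2⟩
            refine ⟨⟨h1, fun i hi hi2 => ?_⟩, h3⟩
            rcases hi.eq_or_lt with rfl | hi
            · rwa [h1.2]
            · exact h2 i hi (by omega)
        have e2 : ∀ y, P.real ({w | (φ (fun i => Y i w) ∧ Y n w = x) ∧
            ∀ i, n ≤ i → i ≤ n + (k + 1) → Y i w ∉ D} ∩ {w | Y (n + 1) w = y}) =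
            P.real {w | φ (fun i => Y i w) ∧ Y n w = x} * (p x y * avoidProb p D k y) := by
          intro y
          rw [e, ih (n + 1) (fun a => φ a ∧ a n = x) _ y, ← mul_assoc, ← h.markov n φ hφ x y]
          · congr 2
            ext w
            exact and_assoc
          · rintro a b hab ⟨h1, h2⟩
            exact ⟨hφ a b (fun i hi => hab i (by omega)) h1, (hab n (by omega)) ▸ h2⟩
        simp_rw [e2]
        rw [← Finset.mul_sum]
        simp [avoidProb, hx]
      · exact (h.measurableSet_past n (fun a => φ a ∧ a n = x) (fun a b hab h1 =>
          ⟨hφ a b hab h1.1, (hab n le_rfl) ▸ h1.2⟩)).inter (h.measurableSet_forall_le n _ Dᶜ)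

theorem avoidProb_of_mem {D : Set E} {x : E} (hx : x ∈ D) (k : ℕ) : avoidProb p D k x = 0 := by
  cases k <;> simp [avoidProb, hx]

/-- With the factor `c` this is the probability of starting at `x` and avoiding `D`, and longer
avoidance is a smaller event. -/
theorem mul_avoidProb_antitone (h : IsSymmChain P Y p c) (D : Set E) (x : E) :
    Antitone fun k => c * avoidProb p D k x := by
  intro k l hkl
  have e := fun k => h.measureReal_avoid D k 0 (fun _ => True) (fun _ _ _ h => h) x
  simp only [true_and, h.stationary] at e
  simp only [← e]
  exact measureReal_mono fun w hw => ⟨hw.1, fun i hi hi2 => hw.2 i hi (by omega)⟩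

/-- Reversibility: the mass with which the chain arrives at `x` after avoiding `D`. -/
theorem measureReal_avoid_eq (h : IsSymmChain P Y p c) (D : Set E) (k : ℕ) (x : E) :
    P.real {w | (∀ i ≤ k, Y i w ∉ D) ∧ Y k w = x} = c * avoidProb p D k x := by
  induction k generalizing x with
  | zero =>
    have e := h.measureReal_avoid D 0 0 (fun _ => True) (fun _ _ _ h => h) x
    simp only [true_and, h.stationary] at e
    rw [← e]
    congr 1
    ext w
    simp [and_comm]
  | succ k ih =>
    by_cases hx : x ∈ D
    · rw [avoidProb_of_mem hx, mul_zero]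
      have : {w | (∀ i ≤ k + 1, Y i w ∉ D) ∧ Y (k + 1) w = x} = ∅ := by
        ext w
        simp only [Set.mem_ofPred_eq, Set.mem_empty_iff_false, iff_false]
        rintro ⟨h1, rfl⟩
        exact h1 _ le_rfl hx
      rw [this]; simp
    · rw [h.measureReal_eq_sum k]
      · have e : ∀ y, P.real ({w | (∀ i ≤ k + 1, Y i w ∉ D) ∧ Y (k + 1) w = x} ∩
            {w | Y k w = y}) = c * (p x y * avoidProb p D k y) := by
          intro y
          -- Symmetry of `p` turns the first step of the forward recursion for `avoidProb` into the
          -- last step of the path arriving at `x`.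
          rw [h.symm x y, mul_comm (p y x), ← mul_assoc, ← ih, ← h.markov k
            (fun a => ∀ i ≤ k, a i ∉ D) (fun a b hab h1 i hi => hab i hi ▸ h1 i hi) y x]
          congr 1
          ext w
          simp only [Set.mem_inter_iff, Set.mem_ofPred_eq]
          constructor
          · rintro ⟨⟨h1, h2⟩, h3⟩
            exact ⟨fun i hi => h1 i (by omega), h3, h2⟩
          · rintro ⟨h1, h2, h3⟩
            refine ⟨⟨fun i hi => ?_, h3⟩, h2⟩
            rcases Nat.le_succ_iff.1 hi with hi | rfl
            · exact h1 i hi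
            · rwa [h3]
        simp_rw [e]
        rw [← Finset.mul_sum]
        simp [avoidProb, hx]
      · exact h.measurableSet_past (k + 1) (fun a => (∀ i ≤ k + 1, a i ∉ D) ∧ a (k + 1) = x)
          fun a b hab h1 => ⟨fun i hi => hab i hi ▸ h1.1 i hi, hab _ le_rfl ▸ h1.2⟩

end IsSymmChain

/-! ### Hitting estimates: first moment and last visit. -/

/-- Either `D` is occupied at time `m`, or it is entered at one of the `N` following steps. -/
theorem measureReal_exists_mem_le {Ω E : Type*} [MeasurableSpace Ω] {P : Measure Ω}
    [IsProbabilityMeasure P] {Y : ℕ → Ω → E} (d e : ℝ) (D : Set E)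
    (hd : ∀ n, P.real {w | Y n w ∈ D} ≤ d)
    (he : ∀ n, P.real {w | Y n w ∉ D ∧ Y (n + 1) w ∈ D} ≤ e) (m N : ℕ) :
    P.real {w | ∃ i, m ≤ i ∧ i ≤ m + N ∧ Y i w ∈ D} ≤ d + N * e := by
  induction N with
  | zero =>
    simp only [CharP.cast_eq_zero, zero_mul, add_zero]
    refine le_trans (measureReal_mono ?_) (hd m)
    rintro w ⟨i, h1, h2, h3⟩
    rwa [← le_antisymm h2 h1] at *
  | succ N ih =>
    have hsub : {w | ∃ i, m ≤ i ∧ i ≤ m + (N + 1) ∧ Y i w ∈ D} ⊆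
        {w | ∃ i, m ≤ i ∧ i ≤ m + N ∧ Y i w ∈ D} ∪
          {w | Y (m + N) w ∉ D ∧ Y (m + N + 1) w ∈ D} := by
      rintro w ⟨i, h1, h2, h3⟩
      by_cases hi : i ≤ m + N
      · exact Or.inl ⟨i, h1, hi, h3⟩
      · obtain rfl : i = m + N + 1 := by omega
        by_cases hD : Y (m + N) w ∈ D
        · exact Or.inl ⟨m + N, by omega, le_rfl, hD⟩
        · exact Or.inr ⟨hD, h3⟩
    have := (measureReal_mono hsub).trans (measureReal_union_le (μ := P) _ _)
    push_cast
    linarith [he (m + N)]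

namespace IsSymmChain

variable {Ω E : Type*} [MeasurableSpace Ω] {P : Measure Ω} [IsProbabilityMeasure P] [Fintype E]
  {Y : ℕ → Ω → E} {p : E → E → ℝ} {c : ℝ}

theorem measureReal_step_mem (h : IsSymmChain P Y p c) (n : ℕ) (φ : (ℕ → E) → Prop)
    (hφ : ∀ a b, (∀ i ≤ n, a i = b i) → φ a → φ b) (x : E) (S : Set E) :
    P.real {w | φ (fun i => Y i w) ∧ Y n w = x ∧ Y (n + 1) w ∈ S} =
      P.real {w | φ (fun i => Y i w) ∧ Y n w = x} * ∑ y, S.indicator (p x) y := by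
  rw [h.measureReal_eq_sum (n + 1)
    (h.measurableSet_past (n + 1) (fun a => φ a ∧ a n = x ∧ a (n + 1) ∈ S)
      fun a b hab h1 => ⟨hφ a b (fun i hi => hab i (by omega)) h1.1,
        hab n (by omega) ▸ h1.2.1, hab _ le_rfl ▸ h1.2.2⟩), Finset.mul_sum]
  refine Finset.sum_congr rfl fun y _ => ?_
  by_cases hy : y ∈ S
  · rw [Set.indicator_of_mem hy, ← h.markov n φ hφ x y]
    congr 1
    ext w
    simp only [Set.mem_inter_iff, Set.mem_ofPred_eq]
    constructor
    · rintro ⟨⟨h1, h2, h3⟩, h4⟩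
      exact ⟨h1, h2, h4⟩
    · rintro ⟨h1, h2, h4⟩
      exact ⟨⟨h1, h2, by rwa [h4]⟩, h4⟩
  · rw [Set.indicator_of_notMem hy, mul_zero]
    have : {w | φ (fun i => Y i w) ∧ Y n w = x ∧ Y (n + 1) w ∈ S} ∩ {w | Y (n + 1) w = y} = ∅ := by
      ext w
      simp only [Set.mem_inter_iff, Set.mem_ofPred_eq, Set.mem_empty_iff_false, iff_false]
      rintro ⟨⟨-, -, h3⟩, rfl⟩
      exact hy h3
    rw [this]; simp

/-- Detailed balance: the flow from `S` into `x` equals the flow from `x` into `S`. -/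
theorem measureReal_mem_step (h : IsSymmChain P Y p c) (n : ℕ) (x : E) (S : Set E) :
    P.real {w | Y n w ∈ S ∧ Y (n + 1) w = x} = c * ∑ y, S.indicator (p x) y := by
  rw [h.measureReal_eq_sum n
    (show MeasurableSet {w | Y n w ∈ S ∧ Y (n + 1) w = x} from
      (h.measurableSet_rel n S).inter (h.measurableSet_eq (n + 1) x)), Finset.mul_sum]
  refine Finset.sum_congr rfl fun y _ => ?_
  by_cases hy : y ∈ S
  · have e := h.markov n (fun _ => True) (fun _ _ _ h => h) y x
    simp only [true_and, h.stationary] at e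
    rw [Set.indicator_of_mem hy, h.symm x y, ← e]
    congr 1
    ext w
    simp only [Set.mem_inter_iff, Set.mem_ofPred_eq]
    constructor
    · rintro ⟨⟨h1, h2⟩, h4⟩
      exact ⟨h4, h2⟩
    · rintro ⟨h1, h2⟩
      exact ⟨⟨by rwa [h1], h2⟩, h1⟩
  · rw [Set.indicator_of_notMem hy, mul_zero]
    have : {w | Y n w ∈ S ∧ Y (n + 1) w = x} ∩ {w | Y n w = y} = ∅ := by
      ext w
      simp only [Set.mem_inter_iff, Set.mem_ofPred_eq, Set.mem_empty_iff_false, iff_false]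
      rintro ⟨⟨h3, -⟩, rfl⟩
      exact hy h3
    rw [this]; simp

open Classical in
/-- The flow of mass into `D` from the points, reached after avoiding `D` during `k` steps, from
which `D` is avoided during `k` steps with probability greater than `lam`. -/
noncomputable def isolatedFlow (p : E → E → ℝ) (c : ℝ) (D : Set E) (k : ℕ) (lam : ℝ) : ℝ :=
  ∑ x, if lam < avoidProb p D k x then
    c * avoidProb p D k x * ∑ y, D.indicator (p x) y else 0

/-- Visits to `D` that are followed by an excursion of length `k` away from `D`. -/
theorem measureReal_last_visit_le (h : IsSymmChain P Y p c) (D : Set E) (k n : ℕ) {lam : ℝ}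
    (hlam : 0 ≤ lam) :
    P.real {w | Y n w ∈ D ∧ ∀ i, n + 1 ≤ i → i ≤ n + 1 + k → Y i w ∉ D} ≤
      isolatedFlow p c D k lam + lam * P.real {w | Y n w ∈ D ∧ Y (n + 1) w ∉ D} := by
  classical
  have hm : MeasurableSet {w | Y n w ∈ D ∧ ∀ i, n + 1 ≤ i → i ≤ n + 1 + k → Y i w ∉ D} :=
    (h.measurableSet_rel n D).inter (h.measurableSet_forall_le (n + 1) (n + 1 + k) Dᶜ)
  have hm2 : MeasurableSet {w | Y n w ∈ D ∧ Y (n + 1) w ∉ D} :=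
    (h.measurableSet_rel n D).inter (h.measurableSet_rel (n + 1) Dᶜ)
  rw [h.measureReal_eq_sum (n + 1) hm, h.measureReal_eq_sum (n + 1) hm2, isolatedFlow, Finset.mul_sum, ← Finset.sum_add_distrib]
  refine Finset.sum_le_sum fun x _ => ?_
  have e1 := h.measureReal_avoid D k (n + 1) (fun a => a n ∈ D)
    (fun a b hab ha => hab n (by omega) ▸ ha) x
  rw [h.measureReal_mem_step] at e1
  have e2 : ({w | Y n w ∈ D ∧ ∀ i, n + 1 ≤ i → i ≤ n + 1 + k → Y i w ∉ D} ∩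
      {w | Y (n + 1) w = x}) = {w | (Y n w ∈ D ∧ Y (n + 1) w = x) ∧
        ∀ i, n + 1 ≤ i → i ≤ n + 1 + k → Y i w ∉ D} := by
    ext w
    simp only [Set.mem_inter_iff, Set.mem_ofPred_eq]
    tauto
  have hle : P.real {w | (Y n w ∈ D ∧ Y (n + 1) w = x) ∧
      ∀ i, n + 1 ≤ i → i ≤ n + 1 + k → Y i w ∉ D} ≤ (if lam < avoidProb p D k x then
        c * avoidProb p D k x * ∑ y, D.indicator (p x) y else 0) +
      lam * P.real ({w | Y n w ∈ D ∧ Y (n + 1) w ∉ D} ∩ {w | Y (n + 1) w = x}) := by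
    rw [e1]
    -- Where avoidance is likely, the contribution is exactly the summand of `isolatedFlow`;
    -- elsewhere the factor `avoidProb` is at most `lam`.
    split_ifs with hx
    · have : 0 ≤ lam * P.real ({w | Y n w ∈ D ∧ Y (n + 1) w ∉ D} ∩ {w | Y (n + 1) w = x}) := by
        positivity
      linarith [mul_right_comm c (∑ y, D.indicator (p x) y) (avoidProb p D k x)]
    · rw [zero_add]
      by_cases hxD : x ∈ D
      · rw [avoidProb_of_mem hxD, mul_zero]; positivity
      · have e3 : {w | Y n w ∈ D ∧ Y (n + 1) w ∉ D} ∩ {w | Y (n + 1) w = x} =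
            {w | Y n w ∈ D ∧ Y (n + 1) w = x} := by
          ext w
          simp only [Set.mem_inter_iff, Set.mem_ofPred_eq]
          constructor
          · rintro ⟨⟨h1, h2⟩, h4⟩
            exact ⟨h1, h4⟩
          · rintro ⟨h1, h2⟩
            exact ⟨⟨h1, by rwa [h2]⟩, h2⟩
        have e4 := h.measureReal_mem_step n x D
        rw [e3, e4, mul_comm lam]
        exact mul_le_mul_of_nonneg_left (not_lt.1 hx) (e4 ▸ measureReal_nonneg)
  rwa [← e2] at hle

/-- By reversibility `c * avoidProb p D n x` is the mass arriving at `x` at time `n` after avoiding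
`D`, and it dominates the same quantity for `k`. The flow thus becomes a first entrance into `D` at
time `n + 1`, for each `n ≤ k`. -/
theorem isolatedFlow_le (h : IsSymmChain P Y p c) (D : Set E) {k n : ℕ} (hn : n ≤ k) (lam : ℝ) :
    isolatedFlow p c D k lam ≤ P.real {w | (∀ i ≤ n, Y i w ∉ D) ∧
      lam < avoidProb p D k (Y n w) ∧ Y (n + 1) w ∈ D} := by
  classical
  have hφ : ∀ a b : ℕ → E, (∀ i ≤ n, a i = b i) → (∀ i ≤ n, a i ∉ D) → ∀ i ≤ n, b i ∉ D :=
    fun a b hab ha i hi => hab i hi ▸ ha i hi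
  rw [h.measureReal_eq_sum n (h.measurableSet_past (n + 1) (fun a => (∀ i ≤ n, a i ∉ D) ∧
    lam < avoidProb p D k (a n) ∧ a (n + 1) ∈ D) fun a b hab ha =>
      ⟨hφ a b (fun i hi => hab i (by omega)) ha.1, hab n (by omega) ▸ ha.2.1,
        hab _ le_rfl ▸ ha.2.2⟩), isolatedFlow]
  refine Finset.sum_le_sum fun x _ => ?_
  split_ifs with hx
  · have e := h.measureReal_step_mem n (fun a => ∀ i ≤ n, a i ∉ D) hφ x D
    have e2 : {w | (∀ i ≤ n, Y i w ∉ D) ∧ lam < avoidProb p D k (Y n w) ∧ Y (n + 1) w ∈ D} ∩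
        {w | Y n w = x} = {w | (∀ i ≤ n, Y i w ∉ D) ∧ Y n w = x ∧ Y (n + 1) w ∈ D} := by
      ext w
      simp only [Set.mem_inter_iff, Set.mem_ofPred_eq]
      constructor
      · rintro ⟨⟨h1, h2, h3⟩, h4⟩
        exact ⟨h1, h4, h3⟩
      · rintro ⟨h1, h2, h3⟩
        exact ⟨⟨h1, by rwa [h2], h3⟩, h2⟩
    rw [e2, e, h.measureReal_avoid_eq]
    exact mul_le_mul_of_nonneg_right (h.mul_avoidProb_antitone D x hn)
      (Finset.sum_nonneg fun y _ => Set.indicator_nonneg (fun y _ => h.nonneg x y) y)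
  · exact measureReal_nonneg

/-- The chain rarely sits in `G`, not having met `D` before, at a place from which `D` is likely
to be avoided, if it rarely visits `G` without visiting `D`. -/
theorem measureReal_likely_avoid_le (h : IsSymmChain P Y p c) (D G : Set E) (k : ℕ) {lam : ℝ}
    (hlam : 0 < lam) :
    P.real {w | ∃ n ≤ k, Y n w ∈ G ∧ lam < avoidProb p D k (Y n w) ∧ ∀ i ≤ n, Y i w ∉ D} ≤
      P.real {w | (∃ i ≤ k, Y i w ∈ G) ∧ ∀ i ≤ k, Y i w ∉ D} / lam := by
  classical
  -- Stop at the first time satisfying `C`, so that the events `Φ n` are disjoint. From there `D` is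
  -- avoided for `k` more steps with conditional probability above `lam`, hence throughout the times
  -- `0, …, k`.
  let C : ℕ → (ℕ → E) → Prop := fun n a =>
    a n ∈ G ∧ lam < avoidProb p D k (a n) ∧ ∀ i ≤ n, a i ∉ D
  let Φ : ℕ → (ℕ → E) → Prop := fun n a => C n a ∧ ∀ r < n, ¬ C r a
  have hC : ∀ n a b, (∀ i ≤ n, a i = b i) → C n a → C n b := fun n a b hab ha =>
    ⟨hab n le_rfl ▸ ha.1, hab n le_rfl ▸ ha.2.1, fun i hi => hab i hi ▸ ha.2.2 i hi⟩
  have hΦ : ∀ n a b, (∀ i ≤ n, a i = b i) → Φ n a → Φ n b := fun n a b hab ha =>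
    ⟨hC n a b hab ha.1, fun r hr hb => ha.2 r hr
      (hC r b a (fun i hi => (hab i (by omega)).symm) hb)⟩
  let W : ℕ → Set Ω := fun n =>
    {w | Φ n (fun i => Y i w)} ∩ {w | ∀ i, n ≤ i → i ≤ n + k → Y i w ∈ Dᶜ}
  have hW : ∀ n, MeasurableSet (W n) := fun n =>
    (h.measurableSet_past n (Φ n) (hΦ n)).inter (h.measurableSet_forall_le n (n + k) Dᶜ)
  have hlow : ∀ n, lam * P.real {w | Φ n fun i => Y i w} ≤ P.real (W n) := by
    intro n
    rw [h.measureReal_eq_sum n (hW n), h.measureReal_eq_sum n (h.measurableSet_past n (Φ n) (hΦ n)),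
      Finset.mul_sum]
    refine Finset.sum_le_sum fun x _ => ?_
    have e := h.measureReal_avoid D k n (Φ n) (hΦ n) x
    have e2 : W n ∩ {w | Y n w = x} = {w | (Φ n (fun i => Y i w) ∧ Y n w = x) ∧
        ∀ i, n ≤ i → i ≤ n + k → Y i w ∉ D} := by
      ext w
      simp only [W, Set.mem_inter_iff, Set.mem_ofPred_eq, Set.mem_compl_iff]
      tauto
    rw [e2, e]
    by_cases hx : lam < avoidProb p D k x
    · rw [mul_comm]
      exact mul_le_mul_of_nonneg_left hx.le measureReal_nonneg
    · have : {w | Φ n (fun i => Y i w)} ∩ {w | Y n w = x} = ∅ := by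
        ext w
        simp only [Set.mem_inter_iff, Set.mem_ofPred_eq, Set.mem_empty_iff_false, iff_false]
        rintro ⟨h1, rfl⟩
        exact hx h1.1.2.1
      rw [this]
      simp only [measureReal_empty, mul_zero]
      exact mul_nonneg measureReal_nonneg (h.avoidProb_nonneg D k x)
  rw [le_div_iff₀ hlam, mul_comm]
  have hsub : {w | ∃ n ≤ k, Y n w ∈ G ∧ lam < avoidProb p D k (Y n w) ∧ ∀ i ≤ n, Y i w ∉ D} ⊆
      ⋃ n ∈ Finset.range (k + 1), {w | Φ n fun i => Y i w} := by
    rintro w ⟨n, hn, hw⟩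
    have hex : ∃ n, C n fun i => Y i w := ⟨n, hw⟩
    simp only [Set.mem_iUnion, Finset.mem_range, exists_prop]
    refine ⟨Nat.find hex, ?_, Nat.find_spec hex, fun r hr => Nat.find_min hex hr⟩
    have := Nat.find_min' hex (m := n) hw
    omega
  calc lam * P.real _
      ≤ lam * ∑ n ∈ Finset.range (k + 1), P.real {w | Φ n fun i => Y i w} :=
        mul_le_mul_of_nonneg_left ((measureReal_mono hsub (measure_ne_top _ _)).trans
          (measureReal_biUnion_finset_le _ _)) hlam.le
    _ ≤ ∑ n ∈ Finset.range (k + 1), P.real (W n) := by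
        rw [Finset.mul_sum]
        exact Finset.sum_le_sum fun n _ => hlow n
    _ = P.real (⋃ n ∈ Finset.range (k + 1), W n) := by
        rw [measureReal_biUnion_finset]
        · intro m _ n _ hmn
          refine Set.disjoint_left.2 fun w h1 h2 => ?_
          rcases lt_or_gt_of_ne hmn with hlt | hlt
          · exact h2.1.2 m hlt h1.1.1
          · exact h1.1.2 n hlt h2.1.1
        · exact fun n _ => hW n
    _ ≤ _ := by
        refine measureReal_mono fun w hw => ?_
        simp only [Set.mem_iUnion, Finset.mem_range, exists_prop] at hw
        obtain ⟨n, hn, hw⟩ := hw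
        refine ⟨⟨n, by omega, hw.1.1.1⟩, fun i hi => ?_⟩
        rcases le_total i n with hin | hin
        · exact hw.1.1.2.2 i hin
        · exact hw.2 i hin (by omega)

/-- A bound for the probability that a reversible chain visits `D` during `K` periods of length
`N`, in terms of a larger set `G`. -/
theorem measureReal_hit_le (h : IsSymmChain P Y p c) {D G : Set E} {N : ℕ} (hN : 0 < N) (K : ℕ)
    {lam d e κ : ℝ} (hlam : 0 < lam) (hd : ∀ n, P.real {w | Y n w ∈ D} ≤ d)
    (hin : ∀ n, P.real {w | Y n w ∉ D ∧ Y (n + 1) w ∈ D} ≤ e)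
    (hout : ∀ n, P.real {w | Y n w ∈ D ∧ Y (n + 1) w ∉ D} ≤ e)
    (hκ : ∀ n, P.real {w | Y n w ∉ G ∧ Y (n + 1) w ∈ D} ≤ κ) :
    P.real {w | ∃ i < K * N, Y i w ∈ D} ≤ d + N * e +
      K * (P.real {w | (∃ i < N, Y i w ∈ G) ∧ ∀ i < N, Y i w ∉ D} / lam + N * κ +
        N * (lam * e)) := by
  -- A period has `k + 1` grid times, which is the number of times covered by `avoidProb p D k`.
  obtain ⟨k, rfl⟩ : ∃ k, N = k + 1 := ⟨N - 1, by omega⟩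
  rcases Nat.eq_zero_or_pos K with rfl | hK
  · have h1 : 0 ≤ d := measureReal_nonneg.trans (hd 0)
    have h2 : 0 ≤ e := measureReal_nonneg.trans (hin 0)
    have : {w : Ω | ∃ i < 0 * (k + 1), Y i w ∈ D} = ∅ := by ext w; simp
    rw [this]
    simp only [measureReal_empty, CharP.cast_eq_zero, zero_mul, add_zero]
    positivity
  set β := isolatedFlow p c D k lam
  -- Each of the `k + 1` first-entrance events `T n` has probability at least `β`, and they are
  -- disjoint, so the multiple of `β` is bounded by a single probability.
  have hflow : ((k + 1 : ℕ) : ℝ) * β ≤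
      P.real {w | (∃ i < k + 1, Y i w ∈ G) ∧ ∀ i < k + 1, Y i w ∉ D} / lam +
        ((k + 1 : ℕ) : ℝ) * κ := by
    let T : ℕ → Set Ω := fun n => {w | (∀ i ≤ n, Y i w ∉ D) ∧
      lam < avoidProb p D k (Y n w) ∧ Y (n + 1) w ∈ D}
    have hT : ∀ n, MeasurableSet (T n) := fun n =>
      h.measurableSet_past (n + 1) (fun a => (∀ i ≤ n, a i ∉ D) ∧
        lam < avoidProb p D k (a n) ∧ a (n + 1) ∈ D) fun a b hab ha =>
        ⟨fun i hi => hab i (by omega) ▸ ha.1 i hi, hab n (by omega) ▸ ha.2.1,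
          hab _ le_rfl ▸ ha.2.2⟩
    have h1 : ((k + 1 : ℕ) : ℝ) * β ≤ ∑ n ∈ Finset.range (k + 1), P.real (T n) := by
      rw [← nsmul_eq_mul]
      simpa using Finset.card_nsmul_le_sum (Finset.range (k + 1)) (fun n => P.real (T n)) β
        fun n hn => h.isolatedFlow_le D (by simp at hn; omega) lam
    have h2 : ∑ n ∈ Finset.range (k + 1), P.real (T n) =
        P.real (⋃ n ∈ Finset.range (k + 1), T n) := by
      rw [measureReal_biUnion_finset]
      · intro m _ n _ hmn
        refine Set.disjoint_left.2 fun w h1 h2 => ?_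
        rcases lt_or_gt_of_ne hmn with hlt | hlt
        · exact h2.1 (m + 1) hlt h1.2.2
        · exact h1.1 (n + 1) hlt h2.2.2
      · exact fun n _ => hT n
    have h3 : (⋃ n ∈ Finset.range (k + 1), T n) ⊆
        {w | ∃ n ≤ k, Y n w ∈ G ∧ lam < avoidProb p D k (Y n w) ∧ ∀ i ≤ n, Y i w ∉ D} ∪
          ⋃ n ∈ Finset.range (k + 1), {w | Y n w ∉ G ∧ Y (n + 1) w ∈ D} := by
      intro w hw
      simp only [Set.mem_iUnion, Finset.mem_range, exists_prop] at hw
      obtain ⟨n, hn, hw⟩ := hw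
      by_cases hG : Y n w ∈ G
      · exact Or.inl ⟨n, by omega, hG, hw.2.1, hw.1⟩
      · refine Or.inr ?_
        simp only [Set.mem_iUnion, Finset.mem_range, exists_prop]
        exact ⟨n, hn, hG, hw.2.2⟩
    have h4 := (measureReal_mono (μ := P) h3).trans (measureReal_union_le _ _)
    have h5 : P.real (⋃ n ∈ Finset.range (k + 1), {w | Y n w ∉ G ∧ Y (n + 1) w ∈ D}) ≤
        ((k + 1 : ℕ) : ℝ) * κ := by
      refine (measureReal_biUnion_finset_le _ _).trans ?_
      rw [← nsmul_eq_mul]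
      simpa using Finset.sum_le_card_nsmul (Finset.range (k + 1)) _ κ fun n _ => hκ n
    have h6 := h.measureReal_likely_avoid_le D G k hlam
    simp only [Nat.lt_succ_iff] at *
    linarith
  have hlast : ∀ n, P.real {w | Y n w ∈ D ∧ ∀ i, n + 1 ≤ i → i ≤ n + 1 + k → Y i w ∉ D} ≤
      β + lam * e := fun n =>
    (h.measureReal_last_visit_le D k n hlam.le).trans
      (by linarith [mul_le_mul_of_nonneg_left (hout n) hlam.le])
  obtain ⟨K, rfl⟩ : ∃ K', K = K' + 1 := ⟨K - 1, by omega⟩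
  -- If the last period misses `D`, the last visit is at some `m < K * (k + 1)`, and the whole
  -- stretch `m + 1, …, m + 1 + k` that follows is free of `D`.
  have hsub : {w | ∃ i < (K + 1) * (k + 1), Y i w ∈ D} ⊆
      {w | ∃ i, K * (k + 1) ≤ i ∧ i ≤ K * (k + 1) + k ∧ Y i w ∈ D} ∪
      ⋃ n ∈ Finset.range (K * (k + 1)),
        {w | Y n w ∈ D ∧ ∀ i, n + 1 ≤ i → i ≤ n + 1 + k → Y i w ∉ D} := by
    classical
    rintro w ⟨i, hi, hw⟩
    by_cases hA : ∃ i, K * (k + 1) ≤ i ∧ i ≤ K * (k + 1) + k ∧ Y i w ∈ D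
    · exact Or.inl hA
    · push Not at hA
      refine Or.inr ?_
      simp only [Set.mem_iUnion, Finset.mem_range, exists_prop]
      rw [add_mul, one_mul] at hi
      have hiK : i < K * (k + 1) := by
        by_contra hcon
        exact hA i (by omega) (by omega) hw
      let m := Nat.findGreatest (fun j => Y j w ∈ D) (K * (k + 1) + k)
      have hm : Y m w ∈ D := Nat.findGreatest_spec (P := fun j => Y j w ∈ D) (m := i) (by omega) hw
      have hmle : m ≤ K * (k + 1) + k := Nat.findGreatest_le _
      have hm2 : m < K * (k + 1) := by
        by_contra hcon
        exact hA m (by omega) hmle hm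
      exact ⟨m, hm2, hm, fun j h1 h2 => Nat.findGreatest_is_greatest
        (show m < j by omega) (by omega)⟩
  have h1 := (measureReal_mono (μ := P) hsub).trans (measureReal_union_le _ _)
  have h2 := measureReal_exists_mem_le d e D hd hin (K * (k + 1)) k
  have h3 : P.real (⋃ n ∈ Finset.range (K * (k + 1)),
      {w | Y n w ∈ D ∧ ∀ i, n + 1 ≤ i → i ≤ n + 1 + k → Y i w ∉ D}) ≤
      (K * (k + 1) : ℕ) * (β + lam * e) := by
    refine (measureReal_biUnion_finset_le _ _).trans ?_
    rw [← nsmul_eq_mul]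
    simpa using Finset.sum_le_card_nsmul (Finset.range (K * (k + 1))) _ (β + lam * e)
      fun n _ => hlast n
  have he : 0 ≤ e := measureReal_nonneg.trans (hin 0)
  have hκ0 : 0 ≤ κ := measureReal_nonneg.trans (hκ 0)
  set η := P.real {w | (∃ i < k + 1, Y i w ∈ G) ∧ ∀ i < k + 1, Y i w ∉ D}
  have hη : 0 ≤ η / lam := div_nonneg measureReal_nonneg hlam.le
  have h4 : ((K * (k + 1) : ℕ) : ℝ) * (β + lam * e) ≤
      K * (η / lam + ((k + 1 : ℕ) : ℝ) * κ + ((k + 1 : ℕ) : ℝ) * (lam * e)) := by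
    rw [Nat.cast_mul, mul_assoc]
    refine mul_le_mul_of_nonneg_left ?_ (Nat.cast_nonneg K)
    linarith
  have h5 : (0 : ℝ) ≤ η / lam + ((k + 1 : ℕ) : ℝ) * κ + ((k + 1 : ℕ) : ℝ) * (lam * e) := by
    positivity
  have h6 : ((K + 1 : ℕ) : ℝ) * (η / lam + ((k + 1 : ℕ) : ℝ) * κ + ((k + 1 : ℕ) : ℝ) * (lam * e)) =
    K * (η / lam + ((k + 1 : ℕ) : ℝ) * κ + ((k + 1 : ℕ) : ℝ) * (lam * e)) +
      (η / lam + ((k + 1 : ℕ) : ℝ) * κ + ((k + 1 : ℕ) : ℝ) * (lam * e)) := by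
    push_cast; ring
  have h7 : (k : ℝ) * e ≤ ((k + 1 : ℕ) : ℝ) * e :=
    mul_le_mul_of_nonneg_right (by push_cast; linarith) he
  linarith

end IsSymmChain

/-! ### The dynamics on a time grid as a reversible chain. -/

theorem flipTransition_symm (t : ℝ) (a b : Bool) : flipTransition t a b = flipTransition t b a := by
  simp only [flipTransition_apply, eq_comm]

theorem flipTransition_nonneg {t : ℝ} (ht : 0 ≤ t) (a b : Bool) : 0 ≤ flipTransition t a b := by
  rw [flipTransition_apply]
  have h1 := Real.exp_pos (-t)
  have h2 : Real.exp (-t) ≤ 1 := Real.exp_le_one_iff.2 (by linarith)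
  split_ifs <;> linarith

theorem measureReal_eq_sum_preimage {Ω α : Type*} [MeasurableSpace Ω] [MeasurableSpace α]
    [MeasurableSingletonClass α] [Fintype α] (P : Measure Ω) [IsFiniteMeasure P] {f : Ω → α}
    (hf : Measurable f) (S : Set Ω) : P.real S = ∑ a, P.real (S ∩ f ⁻¹' {a}) := by
  have h : (P.restrict S).real (⋃ a ∈ Finset.univ, f ⁻¹' {a}) =
      ∑ a, (P.restrict S).real (f ⁻¹' {a}) := by
    refine measureReal_biUnion_finset ?_ fun a _ => hf (measurableSet_singleton a)
    intro a _ b _ hab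
    refine Set.disjoint_left.2 fun w h1 h2 => hab ?_
    rw [← show f w = a from h1, ← show f w = b from h2]
  have h2 : (⋃ a ∈ Finset.univ, f ⁻¹' {a}) = Set.univ := by ext w; simp
  rw [h2] at h
  simp only [measureReal_def, Measure.restrict_apply (hf (measurableSet_singleton _)),
    Measure.restrict_apply_univ] at h ⊢
  simpa only [Set.inter_comm] using h

namespace IsFlipDynamics

variable {V Ω : Type*} [MeasurableSpace Ω] {P : Measure Ω} {X : ℝ≥0 → Ω → V → Bool}

theorem measureReal_path (hX : IsFlipDynamics P X) (F : Finset V) (n : ℕ)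
    (t : Fin (n + 1) → ℝ≥0) (ht : Monotone t) (a : Fin (n + 1) → F → Bool) :
    P.real {w | ∀ i, F.restrict (X (t i) w) = a i} =
      ∏ v : F, (1 / 2 * ∏ i : Fin n,
        flipTransition ((t i.succ : ℝ) - (t i.castSucc : ℝ)) (a i.castSucc v) (a i.succ v)) := by
  have h := (hX.indep.precomp (g := ((↑) : F → V)) Subtype.val_injective).measure_inter_preimage_eq_mul
    Finset.univ (sets := fun v => {y | ∀ i, y (t i) = a i v}) (fun v _ => by
      simp only [Set.ofPred_forall]
      exact .iInter fun i => measurableSet_eq_fun (by fun_prop) measurable_const)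
  have e : {w | ∀ i, F.restrict (X (t i) w) = a i} = ⋂ v ∈ (Finset.univ : Finset F),
      (fun (s : Ω) (t : ℝ≥0) => X t s v) ⁻¹'
        {y | ∀ i, y (t i) = a i v} := by
    ext w
    simp only [Set.mem_ofPred_eq, funext_iff, Finset.restrict, Set.mem_iInter, Set.mem_preimage]
    exact ⟨fun h v _ i => h i v, fun h i v => h v (Finset.mem_univ v) i⟩
  rw [measureReal_def, e, h, ENNReal.toReal_prod]
  refine Finset.prod_congr rfl fun v _ => ?_
  rw [← hX.law v n t ht fun i => a i v]
  rfl

/-- The dynamics read at the times `a, a + h, a + 2h, …` on finitely many coordinates. -/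
theorem isSymmChain [IsProbabilityMeasure P] (hX : IsFlipDynamics P X) (F : Finset V) (a h : ℝ≥0) :
    IsSymmChain P (fun (i : ℕ) w => F.restrict (X (a + i * h) w))
      (fun x y => ∏ v, flipTransition h (x v) (y v)) ((1 / 2) ^ F.card) := by
  have hmeas : ∀ i : ℕ, Measurable fun w => F.restrict (X (a + i * h) w) := fun i =>
    (Finset.measurable_restrict F).comp (hX.measurable_eval _)
  have hmono : ∀ n : ℕ, Monotone fun i : Fin n => a + (i : ℕ) * h := fun n i j hij => by
    have : (i : ℕ) ≤ j := hij
    dsimp only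
    gcongr
  refine ⟨fun n x => hmeas n (measurableSet_singleton x),
    fun x y => Finset.prod_nonneg fun v _ => flipTransition_nonneg h.2 _ _,
    fun x y => Finset.prod_congr rfl fun v _ => flipTransition_symm _ _ _, ?_, ?_⟩
  · classical
    intro n φ hφ x y
    have hpath : Measurable fun w (i : Fin (n + 1)) => F.restrict (X (a + (i : ℕ) * h) w) :=
      measurable_pi_iff.2 fun i => hmeas i
    rw [measureReal_eq_sum_preimage P hpath, measureReal_eq_sum_preimage P hpath
      {w | φ (fun i => F.restrict (X (a + i * h) w)) ∧ F.restrict (X (a + n * h) w) = x},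
      Finset.sum_mul]
    refine Finset.sum_congr rfl fun b _ => ?_
    -- The path up to time `n` decides both `φ` and the current position, so the atom of `b` lies
    -- inside the past event or is disjoint from it.
    by_cases hb : (∃ w₀, (fun i : Fin (n + 1) => F.restrict (X (a + (i : ℕ) * h) w₀)) = b ∧
        φ (fun i => F.restrict (X (a + i * h) w₀)) ∧ F.restrict (X (a + n * h) w₀) = x)
    · obtain ⟨w₀, h1, h2, h3⟩ := hb
      have hφb : ∀ w, (fun i : Fin (n + 1) => F.restrict (X (a + (i : ℕ) * h) w)) = b →
          φ (fun i => F.restrict (X (a + i * h) w)) := fun w hw =>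
        hφ _ _ (fun i hi => by
          have e1 := congrFun h1 ⟨i, Nat.lt_succ_of_le hi⟩
          have e2 := congrFun hw ⟨i, Nat.lt_succ_of_le hi⟩
          exact e1.trans e2.symm) h2
      have hbx : b (Fin.last n) = x := by rw [← h1, ← h3]; simp
      have hx : ∀ w, (fun i : Fin (n + 1) => F.restrict (X (a + (i : ℕ) * h) w)) = b →
          F.restrict (X (a + n * h) w) = x := fun w hw => by
        have e2 := congrFun hw (Fin.last n)
        rw [hbx] at e2
        simpa using e2
      have s1 : {w | φ (fun i => F.restrict (X (a + i * h) w)) ∧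
          F.restrict (X (a + n * h) w) = x} ∩
          (fun w (i : Fin (n + 1)) => F.restrict (X (a + (i : ℕ) * h) w)) ⁻¹' {b} =
          {w | ∀ i : Fin (n + 1), F.restrict (X (a + (i : ℕ) * h) w) = b i} := by
        ext w
        simp only [Set.mem_inter_iff, Set.mem_ofPred_eq, Set.mem_preimage,
          Set.mem_singleton_iff]
        constructor
        · rintro ⟨-, rfl⟩ i
          rfl
        · intro hw
          exact ⟨⟨hφb w (funext hw), hx w (funext hw)⟩, funext hw⟩
      have s2 : {w | φ (fun i => F.restrict (X (a + i * h) w)) ∧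
          F.restrict (X (a + n * h) w) = x ∧ F.restrict (X (a + (n + 1 : ℕ) * h) w) = y} ∩
          (fun w (i : Fin (n + 1)) => F.restrict (X (a + (i : ℕ) * h) w)) ⁻¹' {b} =
          {w | ∀ i : Fin (n + 1 + 1), F.restrict (X (a + (i : ℕ) * h) w) =
            Fin.snoc (α := fun _ => F → Bool) b y i} := by
        ext w
        simp only [Set.mem_inter_iff, Set.mem_ofPred_eq, Set.mem_preimage,
          Set.mem_singleton_iff]
        constructor
        · rintro ⟨⟨-, -, h3⟩, rfl⟩ i
          refine Fin.lastCases ?_ (fun i => ?_) i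
          · simpa using h3
          · simp
        · intro hw
          have hw1 : ∀ i : Fin (n + 1), F.restrict (X (a + (i : ℕ) * h) w) = b i := fun i => by
            simpa using hw i.castSucc
          exact ⟨⟨hφb w (funext hw1), hx w (funext hw1), by simpa using hw (Fin.last _)⟩,
            funext hw1⟩
      rw [s1, s2, hX.measureReal_path F n _ (hmono _), hX.measureReal_path F (n + 1) _ (hmono _),
        ← Finset.prod_mul_distrib]
      refine Finset.prod_congr rfl fun v _ => ?_
      rw [Fin.prod_univ_castSucc, mul_assoc]
      congr 2
      · refine Finset.prod_congr rfl fun i _ => ?_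
        rw [Fin.succ_castSucc]
        simp only [Fin.snoc_castSucc, Fin.val_castSucc, Fin.val_succ]
      · rw [Fin.succ_last]
        simp only [Fin.snoc_castSucc, Fin.snoc_last, hbx, Fin.val_last, Fin.val_castSucc]
        congr 1
        push_cast
        ring
    · have s : ∀ S ⊆ {w | φ (fun i => F.restrict (X (a + i * h) w)) ∧
          F.restrict (X (a + n * h) w) = x}, S ∩
          (fun w (i : Fin (n + 1)) => F.restrict (X (a + (i : ℕ) * h) w)) ⁻¹' {b} = ∅ := by
        intro S hS
        ext w
        simp only [Set.mem_inter_iff, Set.mem_preimage, Set.mem_singleton_iff,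
          Set.mem_empty_iff_false, iff_false]
        rintro ⟨h1, h2⟩
        exact hb ⟨w, h2, hS h1⟩
      rw [s _ subset_rfl, s _ fun w hw => ⟨hw.1, hw.2.1⟩]
      simp
  · intro n x
    have e := hX.measureReal_path F 0 (fun _ => a + n * h) (fun _ _ _ => le_rfl) fun _ => x
    simpa using e

end IsFlipDynamics

/-! ### Dyadic grids and the passage to continuous time. -/

/-- The trajectory visits `S` at one of the times `a + i ℓ / 2 ^ j` with `i < K 2 ^ j`. -/
def gridHit {V Ω : Type*} (X : ℝ≥0 → Ω → V → Bool) (a ℓ : ℝ≥0) (K : ℕ) (S : Set (V → Bool))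
    (j : ℕ) : Set Ω :=
  {w | ∃ i < K * 2 ^ j, X (a + i * (ℓ / 2 ^ j)) w ∈ S}

/-- The trajectory visits `S` at one of the times `a + i ℓ / 2 ^ j` with `i < K 2 ^ j`, for
some `j`. -/
def dyadicHit {V Ω : Type*} (X : ℝ≥0 → Ω → V → Bool) (a ℓ : ℝ≥0) (K : ℕ) (S : Set (V → Bool)) :
    Set Ω :=
  ⋃ j, gridHit X a ℓ K S j

theorem gridHit_mono {V Ω : Type*} (X : ℝ≥0 → Ω → V → Bool) (a ℓ : ℝ≥0) (K : ℕ)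
    (S : Set (V → Bool)) : Monotone (gridHit X a ℓ K S) := by
  refine monotone_nat_of_le_succ fun j w => ?_
  rintro ⟨i, hi, hw⟩
  refine ⟨2 * i, by rw [pow_succ, ← mul_assoc]; omega, ?_⟩
  have : ((2 * i : ℕ) : ℝ≥0) * (ℓ / 2 ^ (j + 1)) = i * (ℓ / 2 ^ j) := by
    push_cast
    rw [pow_succ]
    field_simp
  rwa [this]

theorem gridHit_subset {V Ω : Type*} (X : ℝ≥0 → Ω → V → Bool) (a ℓ : ℝ≥0) (K : ℕ)
    {S T : Set (V → Bool)} (hST : S ⊆ T) (j : ℕ) : gridHit X a ℓ K S j ⊆ gridHit X a ℓ K T j :=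
  fun _ ⟨i, hi, hw⟩ => ⟨i, hi, hST hw⟩

theorem dyadicHit_subset {V Ω : Type*} (X : ℝ≥0 → Ω → V → Bool) (a ℓ : ℝ≥0) (K : ℕ)
    {S T : Set (V → Bool)} (hST : S ⊆ T) : dyadicHit X a ℓ K S ⊆ dyadicHit X a ℓ K T :=
  Set.iUnion_mono fun j => gridHit_subset X a ℓ K hST j

namespace IsFlipDynamics

variable {V Ω : Type*} [MeasurableSpace Ω] {P : Measure Ω} {X : ℝ≥0 → Ω → V → Bool}

theorem measurableSet_gridHit (hX : IsFlipDynamics P X) (a ℓ : ℝ≥0) (K : ℕ) {S : Set (V → Bool)}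
    (hS : MeasurableSet S) (j : ℕ) : MeasurableSet (gridHit X a ℓ K S j) := by
  have : gridHit X a ℓ K S j =
      ⋃ i, ⋃ (_ : i < K * 2 ^ j), (X (a + i * (ℓ / 2 ^ j))) ⁻¹' S := by
    ext w; simp [gridHit]
  rw [this]
  exact .iUnion fun i => .iUnion fun _ => hX.measurable_eval _ hS

theorem measurableSet_dyadicHit (hX : IsFlipDynamics P X) (a ℓ : ℝ≥0) (K : ℕ)
    {S : Set (V → Bool)} (hS : MeasurableSet S) : MeasurableSet (dyadicHit X a ℓ K S) :=
  .iUnion fun j => hX.measurableSet_gridHit a ℓ K hS j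

theorem tendsto_gridHit [IsProbabilityMeasure P] (a ℓ : ℝ≥0) (K : ℕ) (S : Set (V → Bool)) :
    Tendsto (fun j => P.real (gridHit X a ℓ K S j)) atTop (𝓝 (P.real (dyadicHit X a ℓ K S))) :=
  (ENNReal.tendsto_toReal (measure_ne_top _ _)).comp
    (tendsto_measure_iUnion_atTop (gridHit_mono X a ℓ K S))

/-- By right continuity, a visit to an event that depends on finitely many coordinates is seen at
dyadic times. -/
theorem ae_mem_dyadicHit (hX : IsFlipDynamics P X) {S : Set (V → Bool)} {F : Finset V}
    (hS : DependsOn (fun x => x ∈ S) (F : Set V)) :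
    ∀ᵐ w ∂P, ∀ (a ℓ : ℝ≥0) (K : ℕ) (t : ℝ≥0), a ≤ t → t < a + K * ℓ → X t w ∈ S →
      w ∈ dyadicHit X a ℓ K S := by
  have hF : ∀ᵐ w ∂P, ∀ v ∈ F, ∀ t, ContinuousWithinAt (fun r => X r w v) (Set.Ici t) t :=
    (Filter.eventually_all_finset F).2 fun v _ => hX.rightCont v
  filter_upwards [hF] with w hw a ℓ K t hat htK hmem
  have hev : ∀ᶠ r in 𝓝[≥] t, X r w ∈ S := by
    have : ∀ᶠ r in 𝓝[≥] t, ∀ v ∈ F, X r w v = X t w v :=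
      (Filter.eventually_all_finset F).2 fun v hv =>
        (hw v hv t).eventually (show ∀ᶠ b in 𝓝 (X t w v), b = X t w v by simp)
    filter_upwards [this] with r hr
    have e : (X r w ∈ S) = (X t w ∈ S) := hS fun v hv => hr v hv
    rwa [e]
  rw [eventually_nhdsWithin_iff, Metric.eventually_nhds_iff] at hev
  obtain ⟨ε, hε, hev⟩ := hev
  have hℓ : 0 < ℓ := by
    by_contra hcon
    have : ℓ = 0 := le_antisymm (not_lt.1 hcon) zero_le
    subst this
    simp only [mul_zero, add_zero] at htK
    exact absurd htK (not_lt.2 hat)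
  have hlim : Tendsto (fun j : ℕ => (ℓ : ℝ) / 2 ^ j) atTop (𝓝 0) := by
    have := (tendsto_pow_atTop_nhds_zero_of_lt_one (r := (1 / 2 : ℝ)) (by norm_num)
      (by norm_num)).const_mul (ℓ : ℝ)
    simpa [div_eq_mul_inv] using this
  -- The first grid time at or after `t` must fall where `S` still occurs and also before the end of
  -- the window, which gives `i < K * 2 ^ j`.
  have hδ : (0 : ℝ) < min ε ((a + K * ℓ : ℝ≥0) - t : ℝ) :=
    lt_min hε (sub_pos.2 (by exact_mod_cast htK))
  obtain ⟨j, hj⟩ := (hlim.eventually (gt_mem_nhds hδ)).exists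
  have hh : (0 : ℝ) < (ℓ : ℝ) / 2 ^ j := by positivity
  set h : ℝ := (ℓ : ℝ) / 2 ^ j
  set i := ⌈((t : ℝ) - a) / h⌉₊
  have h0 : (0 : ℝ) ≤ ((t : ℝ) - a) / h := div_nonneg (sub_nonneg.2 (by exact_mod_cast hat)) hh.le
  have h1 : ((t : ℝ) - a) ≤ i * h := (div_le_iff₀ hh).1 (Nat.le_ceil _)
  have h2 : (i : ℝ) * h < (t : ℝ) - a + h := by
    have := Nat.ceil_lt_add_one h0
    have := mul_lt_mul_of_pos_right this hh
    rwa [add_mul, one_mul, div_mul_cancel₀ _ hh.ne'] at this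
  have hj1 := hj.trans_le (min_le_left _ _)
  have hj2 := hj.trans_le (min_le_right _ _)
  have hr : ((a + i * (ℓ / 2 ^ j) : ℝ≥0) : ℝ) = a + i * h := by push_cast; rfl
  refine Set.mem_iUnion.2 ⟨j, i, ?_, hev ?_ ?_⟩
  · have h3 : (i : ℝ) * h < K * ℓ := by
      push_cast at hj2
      linarith
    have h4 : (K : ℝ) * ℓ = (K * 2 ^ j : ℕ) * h := by
      simp only [h]; push_cast; field_simp
    rw [h4] at h3
    exact_mod_cast lt_of_mul_lt_mul_right h3 hh.le
  · rw [NNReal.dist_eq, hr, abs_of_nonneg (by linarith)]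
    linarith
  · rw [Set.mem_Ici, ← NNReal.coe_le_coe, hr]
    linarith

theorem measureReal_step_le [IsProbabilityMeasure P] (hX : IsFlipDynamics P X)
    {D : Set (V → Bool)} {H : Finset V} (hD : DependsOn (fun x => x ∈ D) (H : Set V))
    {s t h : ℝ≥0} (hst : t = s + h) {S : Set Ω} (hS : S ⊆ {w | ¬ (X s w ∈ D ↔ X t w ∈ D)}) :
    P.real S ≤ h / 2 * (totalInfluence D).toReal := by
  have h1 := (measure_mono hS).trans (hX.measure_change_le (by rw [hst]; simp) hD)
  have h2 := ENNReal.toReal_mono (ENNReal.mul_ne_top ENNReal.ofReal_ne_top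
    (totalInfluence_ne_top hD)) h1
  rw [ENNReal.toReal_mul, ENNReal.toReal_ofReal (by rw [hst]; simp; positivity)] at h2
  rw [measureReal_def]
  refine h2.trans (le_of_eq ?_)
  rw [hst]
  simp

theorem measureReal_mem_eq [IsProbabilityMeasure P] (hX : IsFlipDynamics P X) (t : ℝ≥0)
    {A : Set (V → Bool)} (hA : MeasurableSet A) :
    P.real {w | X t w ∈ A} = (fairBits V A).toReal := by
  rw [measureReal_def, hX.measure_mem t hA]

theorem add_succ_mul (a h : ℝ≥0) (n : ℕ) : a + (n + 1 : ℕ) * h = a + n * h + h := by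
  push_cast; ring

/-- The number of steps times the entry probability per step is `ℓ / 2 * I(D)` for every mesh, so
the discrete first-moment bound survives refinement. -/
theorem measureReal_dyadicHit_le [IsProbabilityMeasure P] (hX : IsFlipDynamics P X)
    {D : Set (V → Bool)} {H : Finset V} (hD : DependsOn (fun x => x ∈ D) (H : Set V))
    (a ℓ : ℝ≥0) : P.real (dyadicHit X a ℓ 1 D) ≤
      (fairBits V D).toReal + ℓ / 2 * (totalInfluence D).toReal := by
  refine le_of_tendsto' (tendsto_gridHit a ℓ 1 D) fun j => ?_
  have h := measureReal_exists_mem_le (P := P) (Y := fun (i : ℕ) w => X (a + i * (ℓ / 2 ^ j)) w)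
    (fairBits V D).toReal ((ℓ / 2 ^ j : ℝ≥0) / 2 * (totalInfluence D).toReal) D
    (fun n => (hX.measureReal_mem_eq _ hD.measurableSet_of_finset).le)
    (fun n => hX.measureReal_step_le hD (add_succ_mul _ _ n) fun w hw => by
      simp only [Set.mem_ofPred_eq] at hw ⊢; tauto) 0 (2 ^ j)
  refine (measureReal_mono ?_).trans (h.trans (le_of_eq ?_))
  · rintro w ⟨i, hi, hw⟩
    exact ⟨i, by omega, by omega, hw⟩
  · push_cast
    field_simp

/-- This is `measureReal_hit_le` in the limit of vanishing mesh. A step from outside `G` into `D ⊆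
G` must change a coordinate in `F`, which yields the term with `F.card`. -/
theorem measureReal_dyadicHit_le_of_subset [IsProbabilityMeasure P] (hX : IsFlipDynamics P X)
    {D G : Set (V → Bool)} {H F : Finset V} (hD : DependsOn (fun x => x ∈ D) (H : Set V))
    (hG : DependsOn (fun x => x ∈ G) (F : Set V)) (hDG : D ⊆ G) (a ℓ : ℝ≥0) (K : ℕ) {lam : ℝ}
    (hlam : 0 < lam) :
    P.real (dyadicHit X a ℓ K D) ≤
      (fairBits V D).toReal + ℓ / 2 * (totalInfluence D).toReal +
        K * ((P.real (dyadicHit X a ℓ 1 G) - P.real (dyadicHit X a ℓ 1 D)) / lam +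
          ℓ * (F.card * (fairBits V D).toReal) + ℓ / 2 * (lam * (totalInfluence D).toReal)) := by
  classical
  -- On the right only the visits to `D` still depend on the mesh; visits to `G` are counted at all
  -- dyadic times from the outset.
  have hlim : Tendsto (fun j => (fairBits V D).toReal + ℓ / 2 * (totalInfluence D).toReal +
        K * ((P.real (dyadicHit X a ℓ 1 G) - P.real (gridHit X a ℓ 1 D j)) / lam +
          ℓ * (F.card * (fairBits V D).toReal) + ℓ / 2 * (lam * (totalInfluence D).toReal)))
      atTop (𝓝 ((fairBits V D).toReal + ℓ / 2 * (totalInfluence D).toReal +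
        K * ((P.real (dyadicHit X a ℓ 1 G) - P.real (dyadicHit X a ℓ 1 D)) / lam +
          ℓ * (F.card * (fairBits V D).toReal) +
            ℓ / 2 * (lam * (totalInfluence D).toReal)))) :=
    (((((tendsto_gridHit a ℓ 1 D).const_sub _).div_const _).add_const _).add_const _
      |>.const_mul _).const_add _
  refine le_of_tendsto_of_tendsto' (tendsto_gridHit a ℓ K D) hlim fun j => ?_
  set h : ℝ≥0 := ℓ / 2 ^ j
  have hmD := hD.measurableSet_of_finset
  have hD' : DependsOn (fun x => x ∈ D) ((H ∪ F : Finset V) : Set V) :=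
    hD.mono (by simp)
  have hG' : DependsOn (fun x => x ∈ G) ((H ∪ F : Finset V) : Set V) :=
    hG.mono (by simp)
  have eD : ∀ x : V → Bool, (H ∪ F).restrict x ∈ (H ∪ F).restrict '' D ↔ x ∈ D := fun x => by
    conv_rhs => rw [hD'.eq_preimage_restrict]
    rfl
  have eG : ∀ x : V → Bool, (H ∪ F).restrict x ∈ (H ∪ F).restrict '' G ↔ x ∈ G := fun x => by
    conv_rhs => rw [hG'.eq_preimage_restrict]
    rfl
  have key := (hX.isSymmChain (H ∪ F) a h).measureReal_hit_le (D := (H ∪ F).restrict '' D)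
    (G := (H ∪ F).restrict '' G) (N := 2 ^ j) (by positivity) K hlam
    (d := (fairBits V D).toReal) (e := h / 2 * (totalInfluence D).toReal)
    (κ := F.card * ((fairBits V D).toReal * h))
    (fun n => by simp only [eD]; exact (hX.measureReal_mem_eq _ hmD).le)
    (fun n => by
      simp only [eD]
      exact hX.measureReal_step_le hD (add_succ_mul _ _ n) fun w hw => by
        simp only [Set.mem_ofPred_eq] at hw ⊢; tauto)
    (fun n => by
      simp only [eD]
      exact hX.measureReal_step_le hD (add_succ_mul _ _ n) fun w hw => by
        simp only [Set.mem_ofPred_eq] at hw ⊢; tauto)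
    (fun n => by
      simp only [eD, eG, add_succ_mul]
      have h1 := hX.measure_mem_inter_ne_le (s := a + n * h) (t := a + n * h + h) (by simp) hD F
      have h2 := ENNReal.toReal_mono (ENNReal.mul_ne_top (by simp)
        (ENNReal.mul_ne_top (measure_ne_top _ _) ENNReal.ofReal_ne_top)) h1
      simp only [ENNReal.toReal_mul, ENNReal.toReal_natCast] at h2
      rw [ENNReal.toReal_ofReal (by simp)] at h2
      push_cast at h2
      rw [add_sub_cancel_left] at h2
      refine le_trans (measureReal_mono ?_) h2
      rintro w ⟨hw1, hw2⟩
      refine ⟨hw2, ?_⟩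
      by_contra hcon
      push Not at hcon
      have e : (X (a + n * h) w ∈ G) = (X (a + n * h + h) w ∈ G) :=
        hG fun v hv => hcon v hv
      exact hw1 (e ▸ hDG hw2))
  simp only [eD, eG] at key
  refine key.trans ?_
  have hNh : ((2 ^ j : ℕ) : ℝ) * h = ℓ := by
    simp only [h]; push_cast; field_simp
  have hη : P.real {w | (∃ i : ℕ, i < 2 ^ j ∧ X (a + i * h) w ∈ G) ∧
      ∀ i : ℕ, i < 2 ^ j → X (a + i * h) w ∉ D} ≤
      P.real (dyadicHit X a ℓ 1 G) - P.real (gridHit X a ℓ 1 D j) := by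
    have hsub : gridHit X a ℓ 1 D j ⊆ dyadicHit X a ℓ 1 G :=
      (gridHit_subset X a ℓ 1 hDG j).trans (Set.subset_iUnion _ j)
    rw [← measureReal_sdiff hsub (hX.measurableSet_gridHit a ℓ 1 hmD j)]
    refine measureReal_mono ?_
    rintro w ⟨⟨i, hi, hw⟩, hw2⟩
    refine ⟨Set.mem_iUnion.2 ⟨j, i, by simpa using hi, hw⟩, ?_⟩
    rintro ⟨i, hi, hw⟩
    exact hw2 i (by simpa using hi) hw
  have e1 : ((2 ^ j : ℕ) : ℝ) * (h / 2 * (totalInfluence D).toReal) =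
      ℓ / 2 * (totalInfluence D).toReal := by rw [← hNh]; ring
  have e2 : ((2 ^ j : ℕ) : ℝ) * (F.card * ((fairBits V D).toReal * h)) =
      ℓ * (F.card * (fairBits V D).toReal) := by rw [← hNh]; ring
  have e3 : ((2 ^ j : ℕ) : ℝ) * (lam * (h / 2 * (totalInfluence D).toReal)) =
      ℓ / 2 * (lam * (totalInfluence D).toReal) := by rw [← hNh]; ring
  rw [e1, e2, e3]
  gcongr

end IsFlipDynamics

/-! ### Bounded influences: no exceptional times. -/

theorem exists_dependsOn_forall_le {V : Type*} {B : ℕ → Set (V → Bool)}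
    (hB : ∀ n, ∃ F : Finset V, DependsOn (fun x => x ∈ B n) (F : Set V)) (m : ℕ) :
    ∃ F : Finset V, DependsOn (fun x => x ∈ {x | ∀ i ≤ m, x ∈ B i}) (F : Set V) := by
  classical
  choose F hF using hB
  refine ⟨(Finset.range (m + 1)).biUnion F, fun x y hxy => ?_⟩
  have h : ∀ i ≤ m, (x ∈ B i) = (y ∈ B i) := fun i hi => hF i fun v hv =>
    hxy v (by
      simp only [Finset.coe_biUnion, Set.mem_iUnion]
      exact ⟨i, by simpa using Nat.lt_succ_of_le hi, hv⟩)
  simp only [Set.mem_ofPred_eq]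
  exact propext (forall₂_congr fun i hi => by rw [h i hi])

namespace IsFlipDynamics

variable {V Ω : Type*} [MeasurableSpace Ω] {P : Measure Ω} [IsProbabilityMeasure P]
  {X : ℝ≥0 → Ω → V → Bool}

/-- Almost surely, there is no time before `L` at which all the events `B n` occur, if their
probabilities tend to zero and their total influences are bounded. -/
theorem measureReal_exceptional_eq_zero (hX : IsFlipDynamics P X) {B : ℕ → Set (V → Bool)}
    (hB : ∀ n, ∃ F : Finset V, DependsOn (fun x => x ∈ B n) (F : Set V))
    (hlim : Tendsto (fun n => fairBits V (B n)) atTop (𝓝 0)) {C : ℝ}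
    (hC : ∀ n, (totalInfluence (B n)).toReal ≤ C) (L : ℝ≥0) :
    P.real {w | ∃ t < L, ∀ n, X t w ∈ B n} = 0 := by
  classical
  have hC0 : 0 ≤ C := ENNReal.toReal_nonneg.trans (hC 0)
  set q := P.real {w | ∃ t < L, ∀ n, X t w ∈ B n}
  let G : ℕ → Set (V → Bool) := fun m => {x | ∀ i ≤ m, x ∈ B i}
  have hG : ∀ m, ∃ F : Finset V, DependsOn (fun x => x ∈ G m) (F : Set V) :=
    exists_dependsOn_forall_le hB
  have hGanti : Antitone G := fun m n hmn x hx i hi => hx i (hi.trans hmn)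
  let b : ℕ → ℝ := fun n => (fairBits V (B n)).toReal
  have hb : Tendsto b atTop (𝓝 0) := by
    have := (ENNReal.tendsto_toReal ENNReal.zero_ne_top).comp hlim
    rwa [ENNReal.toReal_zero] at this
  have hq : ∀ (ℓ : ℝ≥0) (K : ℕ), (K : ℝ≥0) * ℓ = L → ∀ n,
      q ≤ P.real (dyadicHit X 0 ℓ K (G n)) := by
    intro ℓ K hKℓ n
    obtain ⟨F, hF⟩ := hG n
    refine ENNReal.toReal_mono (measure_ne_top _ _) (measure_mono_ae ?_)
    filter_upwards [hX.ae_mem_dyadicHit hF] with w hw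
    rintro ⟨t, ht, hmem⟩
    exact hw 0 ℓ K t zero_le (by rwa [zero_add, hKℓ]) fun i _ => hmem i
  have hmain : ∀ (ℓ : ℝ≥0) (K : ℕ), (K : ℝ≥0) * ℓ = L → ∀ lam : ℝ, 0 < lam →
      q ≤ ℓ / 2 * C + K * (ℓ / 2 * (lam * C)) := by
    intro ℓ K hKℓ lam hlam
    let u : ℕ → ℝ := fun m => P.real (dyadicHit X 0 ℓ 1 (G m))
    have hu : Antitone u := fun m n hmn => measureReal_mono (dyadicHit_subset X 0 ℓ 1 (hGanti hmn))
    have hbdd : BddBelow (Set.range u) := ⟨0, by rintro _ ⟨n, rfl⟩; exact measureReal_nonneg⟩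
    set r := ⨅ n, u n
    have hr : Tendsto u atTop (𝓝 r) := tendsto_atTop_ciInf hu hbdd
    have hm : ∀ m, q ≤ ℓ / 2 * C + K * ((u m - r) / lam + ℓ / 2 * (lam * C)) := by
      intro m
      obtain ⟨F, hF⟩ := hG m
      -- First `n → ∞` with `m` fixed: every term carrying `F.card` disappears with the probability
      -- of `B n`.
      have hlimn : Tendsto (fun n => b n + ℓ / 2 * (C + F.card * b n) +
          K * ((u m - r) / lam + ℓ * (F.card * b n) + ℓ / 2 * (lam * (C + F.card * b n)))) atTop
          (𝓝 (0 + ℓ / 2 * (C + F.card * 0) +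
            K * ((u m - r) / lam + ℓ * (F.card * 0) + ℓ / 2 * (lam * (C + F.card * 0))))) := by
        have h1 := hb.const_mul (F.card : ℝ)
        have h2 := h1.const_add C
        exact (hb.add (h2.const_mul _)).add
          ((((h1.const_mul (ℓ : ℝ)).const_add _).add ((h2.const_mul lam).const_mul _)).const_mul _)
      simp only [mul_zero, add_zero, zero_add] at hlimn
      refine ge_of_tendsto hlimn ((eventually_ge_atTop m).mono fun n hn => ?_)
      obtain ⟨H, hH⟩ := hB n
      -- `B n ∩ G m` is used instead of `G n` because its influence exceeds that of `B n` by at most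
      -- `F.card * b n`, where `F` depends on `m` only.
      have hD : DependsOn (fun x => x ∈ B n ∩ G m) ((H ∪ F : Finset V) : Set V) := by
        rw [Finset.coe_union]
        exact dependsOn_inter hH hF
      have hsub : G n ⊆ B n ∩ G m := fun x hx => ⟨hx n le_rfl, hGanti hn hx⟩
      have h1 := hX.measureReal_dyadicHit_le_of_subset hD hF Set.inter_subset_right 0 ℓ K hlam
      have h2 : q ≤ P.real (dyadicHit X 0 ℓ K (B n ∩ G m)) :=
        (hq ℓ K hKℓ n).trans (measureReal_mono (dyadicHit_subset X 0 ℓ K hsub))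
      have h3 : r ≤ P.real (dyadicHit X 0 ℓ 1 (B n ∩ G m)) :=
        (ciInf_le hbdd n).trans (measureReal_mono (dyadicHit_subset X 0 ℓ 1 hsub))
      have h4 : (fairBits V (B n ∩ G m)).toReal ≤ b n :=
        ENNReal.toReal_mono (measure_ne_top _ _) (measure_mono Set.inter_subset_left)
      have h5 : (totalInfluence (B n ∩ G m)).toReal ≤ C + F.card * b n := by
        have hne : (F.card : ℝ≥0∞) * fairBits V (B n) ≠ ⊤ :=
          ENNReal.mul_ne_top (by simp) (measure_ne_top _ _)
        have := ENNReal.toReal_mono (ENNReal.add_ne_top.2 ⟨totalInfluence_ne_top hH, hne⟩)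
          (totalInfluence_inter_le (A := B n) hF)
        rw [ENNReal.toReal_add (totalInfluence_ne_top hH) hne, ENNReal.toReal_mul,
          ENNReal.toReal_natCast] at this
        exact this.trans (by gcongr; exact hC n)
      refine h2.trans (h1.trans ?_)
      gcongr
    -- Then `m → ∞`: the bound `u m - r` on the probability of meeting `G m` without `D` vanishes,
    -- so `lam` can be chosen freely afterwards.
    have hlimm : Tendsto (fun m => ℓ / 2 * C + K * ((u m - r) / lam + ℓ / 2 * (lam * C))) atTop
        (𝓝 (ℓ / 2 * C + K * ((r - r) / lam + ℓ / 2 * (lam * C)))) :=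
      ((((hr.sub_const r).div_const lam).add_const _).const_mul _).const_add _
    have := ge_of_tendsto' hlimm hm
    simpa using this
  have hk : ∀ k : ℕ, q ≤ L * C * (1 / ((k : ℝ) + 1)) := by
    intro k
    -- With `k + 1` periods and `lam = 1 / (k + 1)`, both remaining terms equal `L * C / (2 * (k +
    -- 1))`.
    have h := hmain (L / (k + 1 : ℕ)) (k + 1) (by
      rw [mul_div_cancel₀]; exact_mod_cast Nat.succ_ne_zero k) (1 / ((k : ℝ) + 1)) (by positivity)
    refine h.trans (le_of_eq ?_)
    push_cast
    field_simp
    ring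
  have hlimk : Tendsto (fun k : ℕ => L * C * (1 / ((k : ℝ) + 1))) atTop (𝓝 (L * C * 0)) :=
    tendsto_one_div_add_atTop_nhds_zero_nat.const_mul _
  rw [mul_zero] at hlimk
  exact le_antisymm (ge_of_tendsto' hlimk hk) measureReal_nonneg

theorem ae_exceptionalTimes_eq_empty (hX : IsFlipDynamics P X) {A : ℕ → Set (V → Bool)}
    (hA : ∀ n, ∃ F : Finset V, DependsOn (fun x => x ∈ A n) (F : Set V))
    (hlim : Tendsto (fun n => fairBits V (A n)) atTop (𝓝 0))
    (hI : liminf (fun n => totalInfluence (A n)) atTop < ⊤) :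
    ∀ᵐ s ∂P, exceptionalTimes A (fun t => X t s) = ∅ := by
  obtain ⟨C, hC, hCtop⟩ := exists_between hI
  obtain ⟨φ, hφ, hφC⟩ := extraction_of_frequently_atTop (frequently_lt_of_liminf_lt (by isBoundedDefault) hC)
  have h : ∀ L : ℕ, ∀ᵐ w ∂P, ¬ ∃ t < (L : ℝ≥0), ∀ n, X t w ∈ A (φ n) := by
    intro L
    have := hX.measureReal_exceptional_eq_zero (B := fun n => A (φ n)) (fun n => hA (φ n))
      (hlim.comp hφ.tendsto_atTop) (C := C.toReal)
      (fun n => ENNReal.toReal_mono hCtop.ne (hφC n).le) L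
    rw [measureReal_eq_zero_iff] at this
    rw [ae_iff]
    simpa only [not_not] using this
  filter_upwards [ae_all_iff.2 h] with w hw
  refine Set.eq_empty_iff_forall_notMem.2 fun t ht => ?_
  obtain ⟨L, hL⟩ := exists_nat_gt t
  exact hw L ⟨t, hL, fun n => Set.mem_iInter.1 ht (φ n)⟩

end IsFlipDynamics

/-! ### Covering estimate and Hausdorff dimension. -/

/-- A pivotal configuration lies in `A` or in its flip, both null. In the dimension bound this
forces positive probability once the influence exceeds `1`. -/
theorem totalInfluence_eq_zero {V : Type*} {A : Set (V → Bool)} {F : Finset V}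
    (hA : DependsOn (fun x => x ∈ A) (F : Set V)) (h0 : fairBits V A = 0) :
    totalInfluence A = 0 := by
  classical
  rw [totalInfluence, ENNReal.tsum_eq_zero]
  intro v
  rw [influence]
  refine measure_mono_null (t := A ∪ (fun x => Function.update x v (!x v)) ⁻¹' A) ?_
    (measure_union_null h0 ((fairBits_flip_preimage v hA.measurableSet_of_finset).trans h0))
  intro x hx
  simp only [pivotalSet, Set.mem_ofPred_eq, Set.mem_union, Set.mem_preimage] at *
  by_contra hcon
  apply hx
  push Not at hcon
  exact iff_of_false (by convert hcon.2) hcon.1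

theorem ediam_inter_Ico_le (S : Set ℝ≥0) (a ε : ℝ≥0) :
    Metric.ediam (S ∩ Set.Ico a (a + ε)) ≤ ε := by
  refine Metric.ediam_le fun s hs t ht => ?_
  rw [edist_dist, ← ENNReal.ofReal_coe_nnreal]
  refine ENNReal.ofReal_le_ofReal ?_
  have h1 : (a : ℝ) ≤ s := hs.2.1
  have h2 : (s : ℝ) < a + ε := hs.2.2
  have h3 : (a : ℝ) ≤ t := ht.2.1
  have h4 : (t : ℝ) < a + ε := ht.2.2
  rw [NNReal.dist_eq, abs_le]
  constructor <;> linarith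

/-- The origin of the exponent: after taking logarithms, the conclusion reads `log I < d * (log I -
log x)`. -/
theorem mul_rpow_lt_one {x I d : ℝ} (hx0 : 0 < x) (hx1 : x < 1) (hI : 1 < I)
    (h : (1 - Real.log x / Real.log I)⁻¹ < d) : I * (x / I) ^ d < 1 := by
  have hlI : 0 < Real.log I := Real.log_pos hI
  have hlx : Real.log x < 0 := Real.log_neg hx0 hx1
  have e : 1 - Real.log x / Real.log I = (Real.log I - Real.log x) / Real.log I := by
    field_simp
  rw [e, inv_div, div_lt_iff₀ (by linarith)] at h
  have hpos : 0 < x / I := div_pos hx0 (by linarith)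
  rw [← Real.log_neg_iff (by positivity), Real.log_mul (by linarith) (by positivity),
    Real.log_rpow hpos, Real.log_div hx0.ne' (by linarith)]
  linarith

namespace IsFlipDynamics

variable {V Ω : Type*} [MeasurableSpace Ω] {P : Measure Ω} [IsProbabilityMeasure P]
  {X : ℝ≥0 → Ω → V → Bool}

/-- The expected cost of covering the visits to `A` before time `L` by intervals of length `ε`. -/
theorem lintegral_cover_le (hX : IsFlipDynamics P X) {A : Set (V → Bool)} {F : Finset V}
    (hA : DependsOn (fun x => x ∈ A) (F : Set V)) {ε d' d L : ℝ≥0} (hε0 : 0 < ε) (hε1 : ε ≤ 1)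
    (hεA : (ε : ℝ) * (totalInfluence A).toReal = (fairBits V A).toReal)
    (hcost : (totalInfluence A).toReal * (ε : ℝ) ^ (d' : ℝ) ≤ 1) :
    ∫⁻ w, ∑ i : Fin ⌈L / ε⌉₊, (dyadicHit X ((i : ℕ) * ε) ε 1 A).indicator
      (fun _ => (ε : ℝ≥0∞) ^ (d : ℝ)) w ∂P ≤
      ENNReal.ofReal (3 / 2 * (L + 1) * (ε : ℝ) ^ ((d : ℝ) - d')) := by
  have hmA := hA.measurableSet_of_finset
  have hεr : (0 : ℝ) < ε := hε0
  rw [lintegral_finsetSum _ fun i _ =>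
    measurable_const.indicator (hX.measurableSet_dyadicHit _ ε 1 hmA)]
  set x := (fairBits V A).toReal
  set I := (totalInfluence A).toReal
  have hI : 0 ≤ I := ENNReal.toReal_nonneg
  have hterm : ∀ i : Fin ⌈L / ε⌉₊, ∫⁻ w, (dyadicHit X ((i : ℕ) * ε) ε 1 A).indicator
      (fun _ => (ε : ℝ≥0∞) ^ (d : ℝ)) w ∂P ≤
      ENNReal.ofReal ((ε : ℝ) ^ (d : ℝ) * (3 / 2 * x)) := by
    intro i
    rw [lintegral_indicator_const (hX.measurableSet_dyadicHit _ ε 1 hmA),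
      ENNReal.ofReal_mul (by positivity), ← ENNReal.ofReal_rpow_of_pos hεr,
      ENNReal.ofReal_coe_nnreal]
    refine mul_le_mul' le_rfl ?_
    rw [← ENNReal.ofReal_toReal (measure_ne_top P _)]
    refine ENNReal.ofReal_le_ofReal ((hX.measureReal_dyadicHit_le hA _ ε).trans (le_of_eq ?_))
    change x + ε / 2 * I = _
    rw [← hεA]; ring
  refine (Finset.sum_le_card_nsmul _ _ _ fun i _ => hterm i).trans ?_
  rw [Finset.card_univ, Fintype.card_fin, nsmul_eq_mul, ← ENNReal.ofReal_natCast,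
    ← ENNReal.ofReal_mul (by positivity)]
  refine ENNReal.ofReal_le_ofReal ?_
  have hM : (⌈L / ε⌉₊ : ℝ) * ε ≤ L + 1 := by
    have h1 : (⌈L / ε⌉₊ : ℝ≥0) ≤ L / ε + 1 := (Nat.ceil_lt_add_one zero_le).le
    have h2 : (⌈L / ε⌉₊ : ℝ) ≤ L / ε + 1 := by exact_mod_cast h1
    have h3 := mul_le_mul_of_nonneg_right h2 hεr.le
    rw [add_mul, div_mul_cancel₀ _ hεr.ne', one_mul] at h3
    have : (ε : ℝ) ≤ 1 := hε1
    linarith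
  have e : (ε : ℝ) ^ (d : ℝ) = (ε : ℝ) ^ (d' : ℝ) * (ε : ℝ) ^ ((d : ℝ) - d') := by
    rw [← Real.rpow_add hεr]; congr 1; ring
  calc (⌈L / ε⌉₊ : ℝ) * ((ε : ℝ) ^ (d : ℝ) * (3 / 2 * x))
      = 3 / 2 * ((⌈L / ε⌉₊ : ℝ) * ε) * (I * (ε : ℝ) ^ (d' : ℝ)) * (ε : ℝ) ^ ((d : ℝ) - d') := by
        rw [e, ← hεA]; ring
    _ ≤ 3 / 2 * (L + 1) * 1 * (ε : ℝ) ^ ((d : ℝ) - d') := by gcongr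
    _ = _ := by ring

/-- The gap between `d'` and `d` supplies the factor `ε ^ (d - d')`, which sends the expected
covering cost to zero along the subsequence. -/
theorem ae_dimH_le (hX : IsFlipDynamics P X) {A : ℕ → Set (V → Bool)}
    (hA : ∀ n, ∃ F : Finset V, DependsOn (fun x => x ∈ A n) (F : Set V))
    (hlim : Tendsto (fun n => fairBits V (A n)) atTop (𝓝 0))
    (hI : ∀ᶠ n in atTop, 1 < totalInfluence (A n)) {d' d : ℝ≥0} (hdd : d' < d)
    (hfreq : ∃ᶠ n in atTop, ENNReal.ofReal
          (1 - Real.log (fairBits V (A n)).toReal /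
            Real.log (totalInfluence (A n)).toReal)⁻¹ < d') :
    ∀ᵐ s ∂P, dimH (exceptionalTimes A (fun t => X t s)) ≤ d := by
  have hpi : ∀ᶠ n in atTop, fairBits V (A n) < 1 := hlim.eventually (gt_mem_nhds zero_lt_one)
  obtain ⟨φ, hφ, hφA⟩ := extraction_of_frequently_atTop ((hfreq.and_eventually hI).and_eventually hpi)
  choose F hF using hA
  have hItop : ∀ n, totalInfluence (A n) ≠ ⊤ := fun n => totalInfluence_ne_top (hF n)
  let x : ℕ → ℝ := fun k => (fairBits V (A (φ k))).toReal
  let I : ℕ → ℝ := fun k => (totalInfluence (A (φ k))).toReal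
  have hI1 : ∀ k, 1 < I k := fun k => by
    have := (ENNReal.toReal_lt_toReal ENNReal.one_ne_top (hItop _)).2 (hφA k).1.2
    simpa using this
  have hx1 : ∀ k, x k < 1 := fun k => by
    have := (ENNReal.toReal_lt_toReal (measure_ne_top _ _) ENNReal.one_ne_top).2 (hφA k).2
    simpa using this
  have hx0 : ∀ k, 0 < x k := fun k => by
    refine ENNReal.toReal_pos (fun h0 => ?_) (measure_ne_top _ _)
    have := (hφA k).1.2
    rw [totalInfluence_eq_zero (hF _) h0] at this
    exact not_lt_zero this
  let ε : ℕ → ℝ≥0 := fun k => ⟨x k / I k, (div_pos (hx0 k) (zero_lt_one.trans (hI1 k))).le⟩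
  have hεr : ∀ k, (ε k : ℝ) = x k / I k := fun k => rfl
  have hε0 : ∀ k, 0 < ε k := fun k => div_pos (hx0 k) (zero_lt_one.trans (hI1 k))
  have hεx : ∀ k, (ε k : ℝ) ≤ x k := fun k => div_le_self (hx0 k).le (hI1 k).le
  have hεlim : Tendsto (fun k => (ε k : ℝ)) atTop (𝓝 0) := by
    have h1 : Tendsto x atTop (𝓝 0) := by
      have := (ENNReal.tendsto_toReal ENNReal.zero_ne_top).comp (hlim.comp hφ.tendsto_atTop)
      rwa [ENNReal.toReal_zero] at this
    exact squeeze_zero (fun k => (ε k).2) hεx h1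
  have hcost : ∀ k, I k * (ε k : ℝ) ^ (d' : ℝ) ≤ 1 := fun k => by
    refine (mul_rpow_lt_one (hx0 k) (hx1 k) (hI1 k) ?_).le
    by_contra hcon
    have := ENNReal.ofReal_le_ofReal (not_lt.1 hcon)
    rw [ENNReal.ofReal_coe_nnreal] at this
    exact absurd (hφA k).1.1 (not_lt.2 this)
  have hd0 : (0 : ℝ) < d := lt_of_le_of_lt d'.2 hdd
  have hL : ∀ L : ℕ, ∀ᵐ w ∂P,
      μH[d] (exceptionalTimes A (fun t => X t w) ∩ Set.Iio (L : ℝ≥0)) = 0 := by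
    intro L
    let Z : ℕ → Ω → ℝ≥0∞ := fun k w => ∑ i : Fin ⌈(L : ℝ≥0) / ε k⌉₊,
      (dyadicHit X ((i : ℕ) * ε k) (ε k) 1 (A (φ k))).indicator
        (fun _ => (ε k : ℝ≥0∞) ^ (d : ℝ)) w
    have hZ : ∀ k, Measurable (Z k) := fun k => Finset.measurable_sum _ fun i _ =>
      measurable_const.indicator
        (hX.measurableSet_dyadicHit _ (ε k) 1 (hF (φ k)).measurableSet_of_finset)
    have hZle : ∀ k, ∫⁻ w, Z k w ∂P ≤
        ENNReal.ofReal (3 / 2 * ((L : ℝ≥0) + 1) * (ε k : ℝ) ^ ((d : ℝ) - d')) := fun k =>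
      hX.lintegral_cover_le (hF (φ k)) (hε0 k) (by exact_mod_cast (hεx k).trans (hx1 k).le)
        (div_mul_cancel₀ _ (zero_lt_one.trans (hI1 k)).ne') (hcost k)
    have hZlim : Tendsto (fun k => ∫⁻ w, Z k w ∂P) atTop (𝓝 0) := by
      refine tendsto_of_tendsto_of_tendsto_of_le_of_le tendsto_const_nhds ?_ (fun _ => zero_le) hZle
      have hs : (0 : ℝ) < d - d' := sub_pos.2 (by exact_mod_cast hdd)
      have h1 := (hεlim.rpow_const (p := (d : ℝ) - d') (Or.inr hs.le)).const_mul
        (3 / 2 * (((L : ℝ≥0) : ℝ) + 1))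
      rw [Real.zero_rpow hs.ne', mul_zero] at h1
      have h2 := ENNReal.tendsto_ofReal h1
      rwa [ENNReal.ofReal_zero] at h2
    -- The costs tend to zero only in mean; Fatou's lemma makes their lower limit vanish almost
    -- surely, which is all the Hausdorff measure bound needs.
    have hfatou : ∫⁻ w, liminf (fun k => Z k w) atTop ∂P = 0 :=
      le_antisymm ((lintegral_liminf_le hZ).trans hZlim.liminf_eq.le) zero_le
    have hZ0 := (lintegral_eq_zero_iff (Measurable.liminf hZ)).1 hfatou
    filter_upwards [hZ0, ae_all_iff.2 fun k => hX.ae_mem_dyadicHit (hF (φ k))] with w hw0 hwhit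
    refine le_antisymm ?_ zero_le
    have hH := Measure.hausdorffMeasure_le_liminf_sum (d : ℝ)
      (exceptionalTimes A (fun t => X t w) ∩ Set.Iio (L : ℝ≥0)) (l := atTop)
      (fun k => (ε k : ℝ≥0∞)) (by
        have := ENNReal.tendsto_ofReal hεlim
        simpa using this)
      (fun k (i : Fin ⌈(L : ℝ≥0) / ε k⌉₊) => exceptionalTimes A (fun t => X t w) ∩
        Set.Ico ((i : ℕ) * ε k) ((i : ℕ) * ε k + ε k))
      (Eventually.of_forall fun k i => ediam_inter_Ico_le _ _ _)
      (Eventually.of_forall fun k t ht => by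
        have hlt : t / ε k < (L : ℝ≥0) / ε k := by
          gcongr
          · exact hε0 k
          · exact ht.2
        have hi : ⌊t / ε k⌋₊ < ⌈(L : ℝ≥0) / ε k⌉₊ := by
          rw [Nat.floor_lt zero_le]
          exact hlt.trans_le (Nat.le_ceil _)
        refine Set.mem_iUnion.2 ⟨⟨⌊t / ε k⌋₊, hi⟩, ht.1, ?_, ?_⟩
        · exact (le_div_iff₀ (hε0 k)).1 (Nat.floor_le zero_le)
        · have := (div_lt_iff₀ (hε0 k)).1 (Nat.lt_floor_add_one (t / ε k))
          rwa [add_mul, one_mul] at this)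
    refine hH.trans ((liminf_le_liminf (Eventually.of_forall fun k => ?_)).trans hw0.le)
    refine Finset.sum_le_sum fun i _ => ?_
    by_cases hi : w ∈ dyadicHit X ((i : ℕ) * ε k) (ε k) 1 (A (φ k))
    · rw [Set.indicator_of_mem hi]
      exact ENNReal.rpow_le_rpow (ediam_inter_Ico_le _ _ _) hd0.le
    · have : exceptionalTimes A (fun t => X t w) ∩
          Set.Ico ((i : ℕ) * ε k) ((i : ℕ) * ε k + ε k) = ∅ := by
        refine Set.eq_empty_iff_forall_notMem.2 fun t ht => hi ?_
        exact hwhit k _ (ε k) 1 t ht.2.1 (by simpa using ht.2.2)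
          (Set.mem_iInter.1 ht.1 (φ k))
      rw [this, Metric.ediam_empty, ENNReal.zero_rpow_of_pos hd0]
      exact zero_le
  filter_upwards [ae_all_iff.2 hL] with w hw
  have hU : exceptionalTimes A (fun t => X t w) =
      ⋃ L : ℕ, exceptionalTimes A (fun t => X t w) ∩ Set.Iio (L : ℝ≥0) := by
    rw [← Set.inter_iUnion, eq_comm, Set.inter_eq_left]
    intro t _
    obtain ⟨L, hL⟩ := exists_nat_gt t
    exact Set.mem_iUnion.2 ⟨L, hL⟩
  rw [hU, dimH_iUnion]
  exact iSup_le fun L => dimH_le_of_hausdorffMeasure_ne_top (by rw [hw L]; exact ENNReal.zero_ne_top)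

end IsFlipDynamics

/-! ### The two regimes combined. -/

theorem theorem8p1 {V : Type*} (A : ℕ → Set (V → Bool))
    (hA : ∀ n, ∃ F : Finset V, DependsOn (fun x => x ∈ A n) (F : Set V))
    (hlim : Tendsto (fun n => fairBits V (A n)) atTop (𝓝 0))
    {Ω : Type*} [MeasurableSpace Ω] (P : Measure Ω) [IsProbabilityMeasure P]
    (X : ℝ≥0 → Ω → V → Bool) (hX : IsFlipDynamics P X) :
    (liminf (fun n => totalInfluence (A n)) atTop < ⊤ →
      ∀ᵐ s ∂P, exceptionalTimes A (fun t => X t s) = ∅) ∧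
    (¬ liminf (fun n => totalInfluence (A n)) atTop < ⊤ →
      ∀ᵐ s ∂P, dimH (exceptionalTimes A (fun t => X t s)) ≤
        liminf (fun n => ENNReal.ofReal
          (1 - Real.log (fairBits V (A n)).toReal /
            Real.log (totalInfluence (A n)).toReal)⁻¹) atTop) := by
  refine ⟨fun hI => hX.ae_exceptionalTimes_eq_empty hA hlim hI, fun hI => ?_⟩
  have hI1 : ∀ᶠ n in atTop, 1 < totalInfluence (A n) :=
    eventually_lt_of_lt_liminf (ENNReal.one_lt_top.trans_le (not_lt.1 hI))
  set α := liminf (fun n => ENNReal.ofReal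
    (1 - Real.log (fairBits V (A n)).toReal / Real.log (totalInfluence (A n)).toReal)⁻¹) atTop
    with hα
  -- Rational thresholds leave only countably many null sets to discard.
  have h : ∀ q : ℚ, ∀ᵐ s ∂P, α < (Real.toNNReal q : ℝ≥0∞) →
      dimH (exceptionalTimes A (fun t => X t s)) ≤ (Real.toNNReal q : ℝ≥0∞) := by
    intro q
    by_cases hq : α < (Real.toNNReal q : ℝ≥0∞)
    · obtain ⟨d', h1, h2⟩ := ENNReal.lt_iff_exists_nnreal_btwn.1 hq
      filter_upwards [hX.ae_dimH_le hA hlim hI1 (ENNReal.coe_lt_coe.1 h2)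
        (frequently_lt_of_liminf_lt (by isBoundedDefault) h1)] with s hs _ using hs
    · exact Eventually.of_forall fun s hs => absurd hs hq
  filter_upwards [ae_all_iff.2 h] with s hs
  by_contra hcon
  obtain ⟨q, -, h1, h2⟩ := ENNReal.lt_iff_exists_rat_btwn.1 (not_le.1 hcon)
  exact absurd (hs q h1) (not_le.2 h2)
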